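/- Let $\ell$ be a positive integer and let $\alpha=(a_1,b_1,c_1)$, $\beta=(a_2,b_2,c_2)$, $\gamma=(a_3,b_3,c_3)$ be pairwise orthogonal vectors in $\mathbb Z^3$, each of Euclidean length $\ell$, so that $\alpha,\beta,\gamma$ are the edges at the origin of a lattice cube $C_\ell$ of side $\ell$. Let $T_\ell$ be either of the two regular tetrahedra whose vertices are vertices of $C_\ell$, i.e. the convex hull of $\{0,\alpha+\beta,\beta+\gamma,\alpha+\gamma\}$ or of $\{\alpha,\beta,\gamma,\alpha+\beta+\gamma\}$. Let $O_\ell$ be the regular octahedron with vertices $\pm\alpha,\pm\beta,\pm\gamma$, or the one whose vertices are the centres of the six faces of the doubled cube $2C_\ell$. Then there are rational numbers $\mu_1,\mu_2,\nu_1,\nu_2$ such that, for every integer $t\ge 0$, $$\#(tT_\ell\cap\mathbb Z^3)=\frac{\ell^3}{3}t^3+\mu_1t^2+\mu_2t+1,\qquad \#(tO_\ell\cap\mathbb Z^3)=\frac{4\ell^3}{3}t^3+\nu_1t^2+\nu_2t+1,$$ and these coefficients satisfy $$\nu_2+2\mu_2=d_1+d_2+d_3+d_4+d_5+d_6,$$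 where, writing $\gcd(v)$ for the greatest common divisor of the three coordinates of $v\in\mathbb Z^3$, $d_1=\gcd(\alpha+\beta)$, $d_2=\gcd(\alpha+\gamma)$, $d_3=\gcd(\beta+\gamma)$ are the gcds of the rows of the matrix with rows $\alpha+\beta,\alpha+\gamma,\beta+\gamma$ that represents $T_\ell$, and $d_4=\gcd(\alpha-\beta)$, $d_5=\gcd(\alpha-\gamma)$, $d_6=\gcd(\gamma-\beta)$ are the gcds of the pairwise differences of the rows. -/

import Mathlib

open scoped Pointwise

namespace LatticeCube

/-- The point of `ℝ³` with the given integer coordinates. -/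
def toReal3 (v : Fin 3 → ℤ) : Fin 3 → ℝ := fun i => (v i : ℝ)

/-- The convex hull in `ℝ³` of a set of lattice points. -/
def latticePolytope (V : Set (Fin 3 → ℤ)) : Set (Fin 3 → ℝ) :=
  convexHull ℝ (toReal3 '' V)

/-- The number of lattice points in the dilate `t P`. -/
noncomputable def latticeCount (P : Set (Fin 3 → ℝ)) (t : ℕ) : ℕ :=
  Set.ncard {z : Fin 3 → ℤ | toReal3 z ∈ (t : ℝ) • P}

/-- The rows `a 0`, `a 1`, `a 2` are pairwise orthogonal integer vectors of length `ℓ`,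
that is, `(1/ℓ) a` is an orthogonal matrix. They are the edge vectors at the origin of a lattice
cube with side length `ℓ`. -/
def IsCubeMatrix (ℓ : ℕ) (a : Matrix (Fin 3) (Fin 3) ℤ) : Prop :=
  ∀ i j, a i ⬝ᵥ a j = if i = j then (ℓ : ℤ) ^ 2 else 0

/-- The regular tetrahedron with vertex at the origin inscribed in the cube. -/
def tetrahedron (a : Matrix (Fin 3) (Fin 3) ℤ) : Set (Fin 3 → ℝ) :=
  latticePolytope {0, a 0 + a 1, a 1 + a 2, a 0 + a 2}

/-- The regular tetrahedron spanned by the four remaining vertices of the cube. -/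
def tetrahedron' (a : Matrix (Fin 3) (Fin 3) ℤ) : Set (Fin 3 → ℝ) :=
  latticePolytope {a 0, a 1, a 2, a 0 + a 1 + a 2}

/-- The regular octahedron whose vertices are plus and minus the edge vectors of the cube. -/
def octahedron (a : Matrix (Fin 3) (Fin 3) ℤ) : Set (Fin 3 → ℝ) :=
  latticePolytope {a 0, -a 0, a 1, -a 1, a 2, -a 2}

/-- The regular octahedron whose vertices are the centres of the faces of the doubled cube
(the cube with edge vectors `2 a 0`, `2 a 1`, `2 a 2` at the origin). -/
def octahedron' (a : Matrix (Fin 3) (Fin 3) ℤ) : Set (Fin 3 → ℝ) :=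
  latticePolytope
    {a 0 + a 1, a 0 + a 2, a 1 + a 2,
      a 0 + a 1 + 2 • a 2, a 0 + a 2 + 2 • a 1, a 1 + a 2 + 2 • a 0}

/-- The greatest common divisor of the three coordinates. -/
def gcd3 (v : Fin 3 → ℤ) : ℕ := Int.gcd (v 0) (Int.gcd (v 1) (v 2))

end LatticeCube

/-! The doubled tetrahedron `2T` is the octahedron `O` together with four translated copies of `T`
at its corners, each sharing one facet with `O`. Counting lattice points in the `t`-th dilates, with
the shared facets counted twice, gives `L_O(t) + 4 L_T(t) = L_T(2t) + F(t)`, where `F` is the total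
count on the four facets of `tT` (`card_octahedronPoints`). Linear coefficients then satisfy `ν₂ +
4μ₂ = 2μ₂ + F₁`, so the claim is that the linear coefficient `F₁` of `F` is the sum of the six gcds.
By Ehrhart theory for lattice triangles each facet contributes half the lattice length of its
boundary, and every edge lies on two facets (`exists_card_faces`); the lattice length of an edge is
the gcd of its edge vector (`intervalCount_segment`).

All counting takes place in barycentric coordinates scaled by `N = 2ℓ²`. The map `baryCoord`
identifies `ℤ³` with a subgroup `Λ` containing `Nℤ³`, and `tT` becomes the standard simplex of size
`Nt`. Sorting points by residue modulo `N` reduces its count to counts of all integer points in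
standard simplices, hence to a cubic polynomial (`exists_card_simplexPoints`). The leading
coefficient is governed by the index of the edge lattice, `2ℓ³` (`card_boxPoints_range_baryCoord`).
-/

namespace LatticeCube

/-! ### Integer points in standard simplices -/

open Classical in
/-- The points of `Λ` in the simplex cut out by `x, y, z ≥ 0` and `x + y + z ≤ m`. -/
noncomputable def simplexPoints (Λ : AddSubgroup (ℤ × ℤ × ℤ)) (m : ℤ) : Finset (ℤ × ℤ × ℤ) :=
  (Finset.Icc (0 : ℤ × ℤ × ℤ) (m, m, m)).filter
    fun x => x ∈ Λ ∧ x.1 + x.2.1 + x.2.2 ≤ m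

theorem mem_simplexPoints {Λ : AddSubgroup (ℤ × ℤ × ℤ)} {m : ℤ} {x : ℤ × ℤ × ℤ} :
    x ∈ simplexPoints Λ m ↔
      x ∈ Λ ∧ 0 ≤ x.1 ∧ 0 ≤ x.2.1 ∧ 0 ≤ x.2.2 ∧ x.1 + x.2.1 + x.2.2 ≤ m := by
  simp only [simplexPoints, Finset.mem_filter, Finset.mem_Icc, Prod.le_def, Prod.fst_zero,
    Prod.snd_zero]
  constructor
  · rintro ⟨⟨⟨h1, h2, h3⟩, -⟩, h, h4⟩
    exact ⟨h, h1, h2, h3, h4⟩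
  · rintro ⟨h, h1, h2, h3, h4⟩
    exact ⟨⟨⟨h1, h2, h3⟩, by omega, by omega, by omega⟩, h, h4⟩

open Classical in
/-- The points of `Λ` in the half-open cube `[0, N)³`. -/
noncomputable def boxPoints (Λ : AddSubgroup (ℤ × ℤ × ℤ)) (N : ℤ) : Finset (ℤ × ℤ × ℤ) :=
  (Finset.Ico (0 : ℤ) N ×ˢ Finset.Ico (0 : ℤ) N ×ˢ Finset.Ico (0 : ℤ) N).filter (· ∈ Λ)

theorem mem_boxPoints {Λ : AddSubgroup (ℤ × ℤ × ℤ)} {N : ℤ} {x : ℤ × ℤ × ℤ} :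
    x ∈ boxPoints Λ N ↔ x ∈ Λ ∧ (0 ≤ x.1 ∧ x.1 < N) ∧ (0 ≤ x.2.1 ∧ x.2.1 < N) ∧
      (0 ≤ x.2.2 ∧ x.2.2 < N) := by
  simp only [boxPoints, Finset.mem_filter, Finset.mem_product, Finset.mem_Ico]
  tauto

theorem card_standard_triangle (m : ℕ) :
    ((((Finset.Icc (0 : ℤ) m ×ˢ Finset.Icc (0 : ℤ) m).filter
      fun x : ℤ × ℤ => x.1 + x.2 = (m : ℤ)).card : ℕ) : ℚ) = m + 1 := by
  have : ((Finset.Icc (0 : ℤ) m ×ˢ Finset.Icc (0 : ℤ) m).filter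
      fun x : ℤ × ℤ => x.1 + x.2 = (m : ℤ)).card = (Finset.Icc (0 : ℤ) m).card := by
    refine Finset.card_nbij' (fun x => x.1) (fun a => (a, m - a)) ?_ ?_ ?_ ?_
    · intro x hx
      simp at hx ⊢
      omega
    · intro x hx
      simp at hx ⊢
      omega
    · rintro ⟨x, y⟩ hx
      simp at hx ⊢
      omega
    · intro x hx
      rfl
  rw [this]
  simp

/-- Points with first coordinate zero form a segment; the others move to the previous slice on
subtracting `(1, 0, 0)`. -/
theorem card_simplexPoints_top_slice (m : ℕ) :
    ((((simplexPoints ⊤ m).filter fun x : ℤ × ℤ × ℤ => x.1 + x.2.1 + x.2.2 = (m : ℤ)).card : ℕ) : ℚ)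
      = (m + 1) * (m + 2) / 2 := by
  induction m with
  | zero =>
    have : (simplexPoints ⊤ ((0 : ℕ) : ℤ)).filter
        (fun x : ℤ × ℤ × ℤ => x.1 + x.2.1 + x.2.2 = ((0 : ℕ) : ℤ)) = {0} := by
      ext ⟨x, y, z⟩
      simp [mem_simplexPoints, Prod.ext_iff]
      omega
    rw [this]
    simp
  | succ m ih =>
    have h := Finset.card_filter_add_card_filter_not
      (s := (simplexPoints ⊤ ((m + 1 : ℕ) : ℤ)).filter
        (fun x : ℤ × ℤ × ℤ => x.1 + x.2.1 + x.2.2 = ((m + 1 : ℕ) : ℤ))) (fun x => x.1 = 0)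
    have h1 : (((simplexPoints ⊤ ((m + 1 : ℕ) : ℤ)).filter
        (fun x : ℤ × ℤ × ℤ => x.1 + x.2.1 + x.2.2 = ((m + 1 : ℕ) : ℤ))).filter (fun x => x.1 = 0)).card
        = ((Finset.Icc (0 : ℤ) (m + 1 : ℕ) ×ˢ Finset.Icc (0 : ℤ) (m + 1 : ℕ)).filter
      fun x : ℤ × ℤ => x.1 + x.2 = ((m + 1 : ℕ) : ℤ)).card := by
      refine Finset.card_nbij' (fun x => x.2) (fun a => (0, a)) ?_ ?_ ?_ ?_
      · rintro ⟨x, y, z⟩ hx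
        simp [mem_simplexPoints] at hx ⊢
        omega
      · rintro ⟨x, y⟩ hx
        simp [mem_simplexPoints] at hx ⊢
        omega
      · rintro ⟨x, y, z⟩ hx
        simp at hx ⊢
        omega
      · rintro ⟨x, y⟩ hx
        rfl
    have h2 : (((simplexPoints ⊤ ((m + 1 : ℕ) : ℤ)).filter
        (fun x : ℤ × ℤ × ℤ => x.1 + x.2.1 + x.2.2 = ((m + 1 : ℕ) : ℤ))).filter (fun x => ¬ x.1 = 0)).card
        = ((simplexPoints ⊤ m).filter fun x : ℤ × ℤ × ℤ => x.1 + x.2.1 + x.2.2 = (m : ℤ)).card := by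
      refine Finset.card_nbij' (fun x => x - (1, 0, 0)) (fun a => a + (1, 0, 0)) ?_ ?_ ?_ ?_
      · rintro ⟨x, y, z⟩ hx
        simp [mem_simplexPoints] at hx ⊢
        omega
      · rintro ⟨x, y, z⟩ hx
        simp [mem_simplexPoints] at hx ⊢
        omega
      · intro x hx
        simp
      · intro x hx
        simp
    rw [← h, h1, h2]
    push_cast
    rw [ih]
    have := card_standard_triangle (m + 1)
    push_cast at this ⊢
    rw [this]
    ring

theorem card_simplexPoints_top_natCast (m : ℕ) :
    ((simplexPoints ⊤ m).card : ℚ) = (m + 1) * (m + 2) * (m + 3) / 6 := by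
  induction m with
  | zero =>
    have : simplexPoints ⊤ ((0 : ℕ) : ℤ) = {0} := by
      ext ⟨x, y, z⟩
      simp [mem_simplexPoints, Prod.ext_iff]
      omega
    rw [this]
    norm_num
  | succ m ih =>
    have h := Finset.card_filter_add_card_filter_not
      (s := simplexPoints ⊤ ((m + 1 : ℕ) : ℤ))
        (fun x : ℤ × ℤ × ℤ => x.1 + x.2.1 + x.2.2 = ((m + 1 : ℕ) : ℤ))
    have h2 : (simplexPoints ⊤ ((m + 1 : ℕ) : ℤ)).filter
        (fun x => ¬ x.1 + x.2.1 + x.2.2 = ((m + 1 : ℕ) : ℤ)) = simplexPoints ⊤ m := by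
      ext ⟨x, y, z⟩
      simp [mem_simplexPoints]
      omega
    rw [← h, h2, Nat.cast_add, ih, card_simplexPoints_top_slice]
    push_cast
    ring

/-- The cubic vanishes at `-1`, `-2`, `-3`, where the simplex is empty. This range is needed because
a residue class can shift the size of the simplex by up to `3`. -/
theorem card_simplexPoints_top {m : ℤ} (hm : -3 ≤ m) :
    ((simplexPoints ⊤ m).card : ℚ) = (m + 1) * (m + 2) * (m + 3) / 6 := by
  rcases le_or_gt 0 m with hpos | hneg
  · lift m to ℕ using hpos
    rw [card_simplexPoints_top_natCast]
    simp
  · have : simplexPoints ⊤ m = ∅ := by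
      ext ⟨x, y, z⟩
      simp [mem_simplexPoints]
      omega
    rw [this]
    interval_cases m <;> norm_num

/-! ### Ehrhart polynomial of the simplex for a subgroup containing `Nℤ³` -/

/-- The subgroup `Λ` contains `N ℤ³`. -/
structure ContainsMultiples (Λ : AddSubgroup (ℤ × ℤ × ℤ)) (N : ℤ) : Prop where
  pos : 0 < N
  mem₀ : (N, 0, 0) ∈ Λ
  mem₁ : (0, N, 0) ∈ Λ
  mem₂ : (0, 0, N) ∈ Λ

theorem ContainsMultiples.mul_mem {Λ : AddSubgroup (ℤ × ℤ × ℤ)} {N : ℤ}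
    (h : ContainsMultiples Λ N) (a b c : ℤ) : (N * a, N * b, N * c) ∈ Λ := by
  have := Λ.add_mem (Λ.add_mem (Λ.zsmul_mem h.mem₀ a) (Λ.zsmul_mem h.mem₁ b))
    (Λ.zsmul_mem h.mem₂ c)
  simpa [mul_comm] using this

theorem ContainsMultiples.add_mul_mem_iff {Λ : AddSubgroup (ℤ × ℤ × ℤ)} {N : ℤ}
    (h : ContainsMultiples Λ N) (x y z a b c : ℤ) :
    (x + N * a, y + N * b, z + N * c) ∈ Λ ↔ (x, y, z) ∈ Λ := by
  have := Λ.add_mem_cancel_right (x := (N * a, N * b, N * c)) (y := (x, y, z))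
    (h.mul_mem a b c)
  simpa using this

/-- Write a point as `N s + r`. Membership in `Λ` depends only on `r`, and since `k` is the ceiling
of `(r.1 + r.2.1 + r.2.2) / N`, the size condition becomes a bound `t - k` on the coordinate sum of
`s`. -/
theorem card_simplexPoints_residue {Λ : AddSubgroup (ℤ × ℤ × ℤ)} {N : ℤ}
    (h : ContainsMultiples Λ N) {r : ℤ × ℤ × ℤ} (hr : r ∈ boxPoints Λ N) (t : ℕ) {k : ℤ}
    (hk : N * (k - 1) < r.1 + r.2.1 + r.2.2) (hk' : r.1 + r.2.1 + r.2.2 ≤ N * k) :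
    ((simplexPoints Λ (N * t)).filter
      fun x => (x.1 % N, x.2.1 % N, x.2.2 % N) = r).card = (simplexPoints ⊤ (t - k)).card := by
  obtain ⟨r₁, r₂, r₃⟩ := r
  simp only [mem_boxPoints] at hr hk hk'
  have hN := h.pos
  have hle : ∀ s : ℤ, N * s + (r₁ + r₂ + r₃) ≤ N * t ↔ s ≤ t - k := by
    intro s
    constructor
    · intro hs
      have : N * (s + k - 1) < N * t := by linarith
      have := lt_of_mul_lt_mul_left this hN.le
      omega
    · intro hs
      have := mul_le_mul_of_nonneg_left hs hN.le
      linarith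
  have hdiv : ∀ a b : ℤ, 0 ≤ b → b < N → (N * a + b) % N = b := by
    intro a b h0 h1
    rw [add_comm, Int.add_mul_emod_self_left, Int.emod_eq_of_lt h0 h1]
  symm
  refine Finset.card_nbij (fun x => (N * x.1 + r₁, N * x.2.1 + r₂, N * x.2.2 + r₃)) ?_ ?_ ?_
  · rintro ⟨x, y, z⟩ hx
    simp only [mem_simplexPoints, Finset.coe_filter, Set.mem_ofPred_eq, SetLike.mem_coe] at hx ⊢
    obtain ⟨-, h0, h1, h2, h3⟩ := hx
    refine ⟨⟨?_, ?_, ?_, ?_, ?_⟩, ?_⟩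
    · have := (h.add_mul_mem_iff r₁ r₂ r₃ x y z).2 hr.1
      simpa only [add_comm] using this
    · have := mul_nonneg hN.le h0; omega
    · have := mul_nonneg hN.le h1; omega
    · have := mul_nonneg hN.le h2; omega
    · have := (hle _).2 h3
      linarith
    · rw [hdiv _ _ hr.2.1.1 hr.2.1.2, hdiv _ _ hr.2.2.1.1 hr.2.2.1.2,
        hdiv _ _ hr.2.2.2.1 hr.2.2.2.2]
  · rintro ⟨x, y, z⟩ - ⟨x', y', z'⟩ - hxy
    simpa [Prod.ext_iff, hN.ne'] using hxy
  · rintro ⟨x, y, z⟩ hx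
    simp only [mem_simplexPoints, Finset.coe_filter, Set.mem_ofPred_eq, Prod.mk.injEq] at hx
    obtain ⟨⟨-, h0, h1, h2, h3⟩, e1, e2, e3⟩ := hx
    refine ⟨(x / N, y / N, z / N), ?_, ?_⟩
    · simp only [SetLike.mem_coe, mem_simplexPoints, AddSubgroup.mem_top, true_and]
      refine ⟨Int.ediv_nonneg h0 hN.le, Int.ediv_nonneg h1 hN.le, Int.ediv_nonneg h2 hN.le,
        (hle _).1 ?_⟩
      have d1 := Int.mul_ediv_add_emod x N
      have d2 := Int.mul_ediv_add_emod y N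
      have d3 := Int.mul_ediv_add_emod z N
      linarith
    · simp only [← e1, ← e2, ← e3, Int.mul_ediv_add_emod]

/-- The number of points of `Λ` in the dilated simplex is a cubic polynomial. -/
theorem exists_card_simplexPoints {Λ : AddSubgroup (ℤ × ℤ × ℤ)} {N : ℤ}
    (h : ContainsMultiples Λ N) : ∃ μ₁ μ₂ : ℚ, ∀ t : ℕ,
      ((simplexPoints Λ (N * t)).card : ℚ) =
        (boxPoints Λ N).card / 6 * (t : ℚ) ^ 3 + μ₁ * (t : ℚ) ^ 2 + μ₂ * t + 1 := by
  have hN := h.pos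
  have hceil : ∀ r : ℤ × ℤ × ℤ, ∃ k : ℤ, r ∈ boxPoints Λ N → k ≤ 3 ∧
      N * (k - 1) < r.1 + r.2.1 + r.2.2 ∧ r.1 + r.2.1 + r.2.2 ≤ N * k := by
    intro r
    -- The ceiling of the quotient, as the negative of a floor.
    refine ⟨-(-(r.1 + r.2.1 + r.2.2) / N), fun hr => ?_⟩
    rw [mem_boxPoints] at hr
    have d1 := Int.mul_ediv_add_emod (-(r.1 + r.2.1 + r.2.2)) N
    have d2 := Int.emod_nonneg (-(r.1 + r.2.1 + r.2.2)) hN.ne'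
    have d3 := Int.emod_lt_of_pos (-(r.1 + r.2.1 + r.2.2)) hN
    have h2 : N * (-(-(r.1 + r.2.1 + r.2.2) / N) - 1) < r.1 + r.2.1 + r.2.2 := by linarith
    refine ⟨?_, h2, by linarith⟩
    have : N * (-(-(r.1 + r.2.1 + r.2.2) / N) - 1) < N * 3 := by linarith
    have := lt_of_mul_lt_mul_left this hN.le
    omega
  choose k hk using hceil
  have key : ∀ t : ℕ, ((simplexPoints Λ (N * t)).card : ℚ) =
      ∑ r ∈ boxPoints Λ N, ((t : ℚ) - k r + 1) * (t - k r + 2) * (t - k r + 3) / 6 := by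
    intro t
    rw [Finset.card_eq_sum_card_fiberwise (t := boxPoints Λ N)
      (f := fun x => (x.1 % N, x.2.1 % N, x.2.2 % N))]
    · push_cast
      refine Finset.sum_congr rfl fun r hr => ?_
      obtain ⟨h1, h2, h3⟩ := hk r hr
      rw [card_simplexPoints_residue h hr t h2 h3, card_simplexPoints_top (by omega)]
      push_cast
      rfl
    · rintro ⟨x, y, z⟩ hx
      simp only [SetLike.mem_coe, mem_simplexPoints] at hx
      simp only [SetLike.mem_coe, mem_boxPoints]
      refine ⟨?_, ⟨Int.emod_nonneg _ hN.ne', Int.emod_lt_of_pos _ hN⟩,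
        ⟨Int.emod_nonneg _ hN.ne', Int.emod_lt_of_pos _ hN⟩,
        ⟨Int.emod_nonneg _ hN.ne', Int.emod_lt_of_pos _ hN⟩⟩
      rw [← h.add_mul_mem_iff _ _ _ (x / N) (y / N) (z / N)]
      simpa only [Int.emod_add_mul_ediv] using hx.1
  have key' : ∀ t : ℕ, ((simplexPoints Λ (N * t)).card : ℚ) =
      (boxPoints Λ N).card / 6 * (t : ℚ) ^ 3 +
        (∑ r ∈ boxPoints Λ N, (6 - 3 * k r : ℚ) / 6) * (t : ℚ) ^ 2 +
        (∑ r ∈ boxPoints Λ N, (3 * k r ^ 2 - 12 * k r + 11 : ℚ) / 6) * t +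
        ∑ r ∈ boxPoints Λ N, (1 - k r : ℚ) * (2 - k r) * (3 - k r) / 6 := by
    intro t
    rw [key, Finset.card_eq_sum_ones, Nat.cast_sum, Finset.sum_div, Finset.sum_mul,
      Finset.sum_mul, Finset.sum_mul, ← Finset.sum_add_distrib, ← Finset.sum_add_distrib,
      ← Finset.sum_add_distrib]
    exact Finset.sum_congr rfl fun r _ => by push_cast; ring
  -- At `t = 0` the simplex is the origin alone, which forces the constant term to be `1`.
  have h0 := key' 0
  have : simplexPoints Λ (N * (0 : ℕ)) = {0} := by
    ext ⟨x, y, z⟩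
    simp only [mem_simplexPoints, Finset.mem_singleton, Prod.ext_iff, Prod.fst_zero,
      Prod.snd_zero]
    constructor
    · intro h
      simp at h
      omega
    · rintro ⟨rfl, rfl, rfl⟩
      exact ⟨Λ.zero_mem, by simp⟩
  rw [this] at h0
  have h1 : ∑ r ∈ boxPoints Λ N, (1 - k r : ℚ) * (2 - k r) * (3 - k r) / 6 = 1 := by
    simpa using h0.symm
  simp only [h1] at key'
  exact ⟨_, _, key'⟩

/-! ### Periodic counting and lattice triangles -/

theorem sum_Ico_mul_of_periodic {N : ℤ} (hN : 0 < N) {f : ℤ → ℚ} (hf : Function.Periodic f N)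
    (t : ℕ) : ∑ x ∈ Finset.Ico 0 (N * t), f x = t * ∑ x ∈ Finset.Ico 0 N, f x := by
  induction t with
  | zero => simp
  | succ t ih =>
    have h0 : 0 ≤ N * (t : ℤ) := by positivity
    have h1 : Finset.Ico 0 (N * ((t + 1 : ℕ) : ℤ)) =
        Finset.Ico 0 (N * (t : ℤ)) ∪ Finset.Ico (N * (t : ℤ)) (N * (t : ℤ) + N) := by
      ext x
      push_cast
      rw [mul_add]
      simp only [Finset.mem_Ico, Finset.mem_union]
      omega
    have h2 : ∑ x ∈ Finset.Ico (N * (t : ℤ)) (N * (t : ℤ) + N), f x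
        = ∑ x ∈ Finset.Ico 0 N, f x := by
      refine Finset.sum_nbij' (fun x => x - N * t) (fun x => x + N * t) ?_ ?_ ?_ ?_ ?_
      · intro x hx
        rw [Finset.mem_Ico] at hx ⊢
        omega
      · intro x hx
        rw [Finset.mem_Ico] at hx ⊢
        omega
      · intro x _
        simp
      · intro x _
        simp
      · intro x _
        rw [mul_comm]
        exact (hf.sub_int_mul_eq (t : ℤ) (x := x)).symm
    rw [h1, Finset.sum_union, ih, h2]
    · push_cast
      ring
    · rw [Finset.disjoint_left]
      intro x
      simp only [Finset.mem_Ico]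
      omega

open Classical in
/-- The number of `0 ≤ x < N` with `p x`. -/
noncomputable def intervalCount (p : ℤ → Prop) (N : ℤ) : ℕ := ((Finset.Ico 0 N).filter p).card

theorem intervalCount_mul {p : ℤ → Prop} {N : ℤ} (hN : 0 < N) (hp : ∀ x, p (x + N) ↔ p x)
    (t : ℕ) : (intervalCount p (N * t) : ℚ) = t * intervalCount p N := by
  classical
  have := sum_Ico_mul_of_periodic hN (f := fun x => if p x then (1 : ℚ) else 0)
    (fun x => by simp only [hp]) t
  simpa [intervalCount] using this

open Classical in
/-- The points of `Q` in the triangle cut out by `x, y ≥ 0` and `x + y ≤ m`. -/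
noncomputable def trianglePoints (Q : AddSubgroup (ℤ × ℤ)) (m : ℤ) : Finset (ℤ × ℤ) :=
  (Finset.Icc 0 m ×ˢ Finset.Icc 0 m).filter fun x => x ∈ Q ∧ x.1 + x.2 ≤ m

theorem mem_trianglePoints {Q : AddSubgroup (ℤ × ℤ)} {m : ℤ} {x : ℤ × ℤ} :
    x ∈ trianglePoints Q m ↔ x ∈ Q ∧ 0 ≤ x.1 ∧ 0 ≤ x.2 ∧ x.1 + x.2 ≤ m := by
  simp only [trianglePoints, Finset.mem_filter, Finset.mem_product, Finset.mem_Icc]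
  constructor
  · rintro ⟨⟨⟨h1, -⟩, h2, -⟩, h, h3⟩
    exact ⟨h, h1, h2, h3⟩
  · rintro ⟨h, h1, h2, h3⟩
    exact ⟨⟨⟨h1, by omega⟩, h2, by omega⟩, h, h3⟩

theorem card_square_of_periodic {Q : AddSubgroup (ℤ × ℤ)} {N : ℤ} (hN : 0 < N)
    (h₀ : (N, 0) ∈ Q) (h₁ : (0, N) ∈ Q) : ∃ c : ℚ, ∀ t : ℕ,
      (∑ x ∈ Finset.Ico 0 (N * t), (intervalCount (fun y => (x, y) ∈ Q) (N * t) : ℚ))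
        = c * t ^ 2 := by
  refine ⟨∑ x ∈ Finset.Ico 0 N, (intervalCount (fun y => (x, y) ∈ Q) N : ℚ), fun t => ?_⟩
  rw [sum_Ico_mul_of_periodic hN]
  · rw [Finset.sum_congr rfl fun x _ => intervalCount_mul hN (fun y => ?_) t, ← Finset.mul_sum]
    · ring
    · simpa using Q.add_mem_cancel_right (x := (0, N)) (y := (x, y)) h₁
  · intro x
    have (y : ℤ) : (x + N, y) ∈ Q ↔ (x, y) ∈ Q := by
      simpa using Q.add_mem_cancel_right (x := (N, 0)) (y := (x, y)) h₀
    simp only [this]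

open Classical in
-- The closed square adds to the half-open one its far sides, which are translates of the near sides
-- by elements of `Q`, and the corner `(m, m)`.
theorem card_closed_square (Q : AddSubgroup (ℤ × ℤ)) {m : ℤ} (hm : 0 ≤ m)
    (h₀ : (m, 0) ∈ Q) (h₁ : (0, m) ∈ Q) :
    ((Finset.Icc 0 m ×ˢ Finset.Icc 0 m).filter (· ∈ Q)).card =
      (∑ x ∈ Finset.Ico 0 m, intervalCount (fun y => (x, y) ∈ Q) m) +
        intervalCount (fun x => (x, 0) ∈ Q) m + intervalCount (fun y => (0, y) ∈ Q) m + 1 := by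
  have hI : Finset.Icc 0 m = insert m (Finset.Ico 0 m) := by
    ext x
    simp only [Finset.mem_Icc, Finset.mem_insert, Finset.mem_Ico]
    omega
  have hm' : m ∉ Finset.Ico 0 m := by simp
  have e1 (y : ℤ) : (m, y) ∈ Q ↔ (0, y) ∈ Q := by
    simpa using Q.add_mem_cancel_right (x := (m, 0)) (y := (0, y)) h₀
  have e2 (x : ℤ) : (x, m) ∈ Q ↔ (x, 0) ∈ Q := by
    simpa using Q.add_mem_cancel_right (x := (0, m)) (y := (x, 0)) h₁
  have h0 : ((0 : ℤ), (0 : ℤ)) ∈ Q := Q.zero_mem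
  simp only [intervalCount, Finset.card_filter, Finset.sum_product]
  simp only [hI, Finset.sum_insert hm', Finset.sum_add_distrib, e1, e2, h0, if_true]
  ring

/-- The point reflection `(x, y) ↦ (m - x, m - y)` preserves `Q` and swaps the two halves of the
square, so twice the triangle is the square plus its diagonal. The final `2` collects the corner of
the square and the last point of the diagonal. -/
theorem two_mul_card_trianglePoints {Q : AddSubgroup (ℤ × ℤ)} {m : ℤ} (hm : 0 ≤ m)
    (h₀ : (m, 0) ∈ Q) (h₁ : (0, m) ∈ Q) :
    2 * (trianglePoints Q m).card = (∑ x ∈ Finset.Ico 0 m, intervalCount (fun y => (x, y) ∈ Q) m) +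
        intervalCount (fun x => (x, 0) ∈ Q) m + intervalCount (fun y => (0, y) ∈ Q) m +
        intervalCount (fun x => (x, -x) ∈ Q) m + 2 := by
  classical
  have hdiag : ((trianglePoints Q m).filter fun x => x.1 + x.2 = m).card =
      intervalCount (fun x => (x, -x) ∈ Q) m + 1 := by
    have e (x : ℤ) : (x, m - x) ∈ Q ↔ (x, -x) ∈ Q := by
      rw [← Q.add_mem_cancel_right (x := (0, m)) (y := (x, -x)) h₁]
      simp [sub_eq_neg_add]
    have hI : (Finset.Icc 0 m).filter (fun x => (x, -x) ∈ Q) =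
        insert m ((Finset.Ico 0 m).filter (fun x => (x, -x) ∈ Q)) := by
      have : (m, -m) ∈ Q := by simpa using Q.sub_mem h₀ h₁
      ext x
      simp only [Finset.mem_Icc, Finset.mem_insert, Finset.mem_Ico, Finset.mem_filter]
      constructor
      · rintro ⟨h1, h2⟩
        by_cases hx : x = m
        · exact Or.inl hx
        · exact Or.inr ⟨by omega, h2⟩
      · rintro (rfl | ⟨h1, h2⟩)
        · exact ⟨by omega, this⟩
        · exact ⟨by omega, h2⟩
    have : ((trianglePoints Q m).filter fun x => x.1 + x.2 = m).card =
        ((Finset.Icc 0 m).filter (fun x => (x, -x) ∈ Q)).card := by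
      refine Finset.card_nbij' (fun x => x.1) (fun x => (x, m - x)) ?_ ?_ ?_ ?_
      · rintro ⟨x, y⟩ hx
        simp only [Finset.coe_filter, mem_trianglePoints, Set.mem_ofPred_eq] at hx
        obtain ⟨⟨h1, h2⟩, rfl⟩ := hx
        simp only [Finset.coe_filter, Set.mem_ofPred_eq, Finset.mem_Icc, ← e]
        exact ⟨by omega, by simpa using h1⟩
      · intro x hx
        simp only [Finset.coe_filter, Finset.mem_Icc, Set.mem_ofPred_eq, ← e] at hx
        simp only [Finset.coe_filter, mem_trianglePoints, Set.mem_ofPred_eq]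
        exact ⟨⟨hx.2, by omega⟩, by omega⟩
      · rintro ⟨x, y⟩ hx
        simp only [Finset.coe_filter, Set.mem_ofPred_eq] at hx
        simp only [Prod.mk.injEq, true_and]
        omega
      · intro x _
        rfl
    rw [this, hI, Finset.card_insert_of_notMem (by simp), intervalCount]
  have hlow : ((Finset.Icc 0 m ×ˢ Finset.Icc 0 m).filter (· ∈ Q)).filter
      (fun x => x.1 + x.2 ≤ m) = trianglePoints Q m := by
    rw [Finset.filter_filter, trianglePoints]
  have hmm : (m, m) ∈ Q := by simpa using Q.add_mem h₀ h₁
  have hflip (x y : ℤ) (h : (x, y) ∈ Q) : (m - x, m - y) ∈ Q := Q.sub_mem hmm h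
  have hhigh : (((Finset.Icc 0 m ×ˢ Finset.Icc 0 m).filter (· ∈ Q)).filter
      (fun x => ¬ x.1 + x.2 ≤ m)).card =
        ((trianglePoints Q m).filter fun x => ¬ x.1 + x.2 = m).card := by
    refine Finset.card_nbij' (fun x => (m - x.1, m - x.2)) (fun x => (m - x.1, m - x.2))
      ?_ ?_ ?_ ?_
    · rintro ⟨x, y⟩ hx
      simp only [Finset.coe_filter, Finset.mem_filter, Finset.mem_product, Finset.mem_Icc,
        Set.mem_ofPred_eq, mem_trianglePoints] at hx ⊢
      exact ⟨⟨hflip _ _ hx.1.2, by omega⟩, by omega⟩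
    · rintro ⟨x, y⟩ hx
      simp only [Finset.coe_filter, Finset.mem_filter, Finset.mem_product, Finset.mem_Icc,
        Set.mem_ofPred_eq, mem_trianglePoints] at hx ⊢
      exact ⟨⟨by omega, hflip _ _ hx.1.1⟩, by omega⟩
    · intro x _
      simp
    · intro x _
      simp
  have s1 := Finset.card_filter_add_card_filter_not
    (s := (Finset.Icc 0 m ×ˢ Finset.Icc 0 m).filter (· ∈ Q)) (fun x => x.1 + x.2 ≤ m)
  have s2 := Finset.card_filter_add_card_filter_not
    (s := trianglePoints Q m) (fun x => x.1 + x.2 = m)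
  rw [card_closed_square Q hm h₀ h₁, hlow, hhigh] at s1
  omega

/-- The Ehrhart formula for the points of a periodic set in a triangle. -/
theorem exists_card_trianglePoints {Q : AddSubgroup (ℤ × ℤ)} {N : ℤ} (hN : 0 < N)
    (h₀ : (N, 0) ∈ Q) (h₁ : (0, N) ∈ Q) : ∃ c : ℚ, ∀ t : ℕ,
      ((trianglePoints Q (N * t)).card : ℚ) = c * t ^ 2 +
        ((intervalCount (fun x => (x, 0) ∈ Q) N : ℚ) + intervalCount (fun y => (0, y) ∈ Q) N +
          intervalCount (fun x => (x, -x) ∈ Q) N) / 2 * t + 1 := by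
  obtain ⟨c, hc⟩ := card_square_of_periodic hN h₀ h₁
  refine ⟨c / 2, fun t => ?_⟩
  have h := two_mul_card_trianglePoints (Q := Q) (m := N * t) (by positivity)
    (by simpa [mul_comm] using Q.zsmul_mem h₀ t) (by simpa [mul_comm] using Q.zsmul_mem h₁ t)
  have h' := congrArg (Nat.cast : ℕ → ℚ) h
  push_cast at h'
  rw [hc, intervalCount_mul hN, intervalCount_mul hN, intervalCount_mul hN] at h'
  · linarith
  · intro x
    have : (N, -N) ∈ Q := by simpa using Q.sub_mem h₀ h₁
    simpa [add_comm] using Q.add_mem_cancel_right (x := (N, -N)) (y := (x, -x)) this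
  · intro x
    simpa using Q.add_mem_cancel_right (x := (0, N)) (y := (0, x)) h₁
  · intro x
    simpa using Q.add_mem_cancel_right (x := (N, 0)) (y := (x, 0)) h₀

/-! ### Cutting the octahedron out of the doubled simplex -/

/-- The points of `Λ` in the octahedron obtained from the simplex `x, y, z ≥ 0`,
`x + y + z ≤ 2 * m` by cutting off the corners. -/
noncomputable def octahedronPoints (Λ : AddSubgroup (ℤ × ℤ × ℤ)) (m : ℤ) :
    Finset (ℤ × ℤ × ℤ) :=
  (simplexPoints Λ (2 * m)).filter
    fun x => x.1 ≤ m ∧ x.2.1 ≤ m ∧ x.2.2 ≤ m ∧ m ≤ x.1 + x.2.1 + x.2.2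

theorem card_corner {Λ : AddSubgroup (ℤ × ℤ × ℤ)} {m : ℤ} {v : ℤ × ℤ × ℤ} (hv : v ∈ Λ)
    (p q : ℤ × ℤ × ℤ → Prop) [DecidablePred p] [DecidablePred q]
    {S : Finset (ℤ × ℤ × ℤ)} (hS : ∀ x ∈ S, x ∈ Λ)
    (h : ∀ x, x + v ∈ S ∧ p (x + v) → x ∈ Λ → x ∈ simplexPoints Λ m ∧ ¬ q x)
    (h' : ∀ x, x ∈ simplexPoints Λ m ∧ ¬ q x → x + v ∈ Λ → x + v ∈ S ∧ p (x + v)) :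
    (S.filter p).card = ((simplexPoints Λ m).filter fun x => ¬ q x).card := by
  refine Finset.card_nbij' (fun x => x - v) (fun x => x + v) ?_ ?_ ?_ ?_
  · intro x hx
    rw [Finset.mem_coe, Finset.mem_filter] at hx ⊢
    exact h _ (by simpa using hx) (Λ.sub_mem (hS x hx.1) hv)
  · intro x hx
    rw [Finset.mem_coe, Finset.mem_filter] at hx ⊢
    exact h' _ hx (Λ.add_mem (mem_simplexPoints.1 hx.1).1 hv)
  · intro x _
    simp
  · intro x _
    simp

/-- The corners removed are cut off by strict inequalities, so each is a copy of the small simplex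
without the facet it shares with the octahedron. The corners are disjoint and can be removed one
after another. -/
theorem card_octahedronPoints {Λ : AddSubgroup (ℤ × ℤ × ℤ)} {m : ℤ} (hm : 0 ≤ m)
    (h₀ : (m, 0, 0) ∈ Λ) (h₁ : (0, m, 0) ∈ Λ) (h₂ : (0, 0, m) ∈ Λ) :
    (octahedronPoints Λ m).card + 4 * (simplexPoints Λ m).card =
      (simplexPoints Λ (2 * m)).card +
        ((simplexPoints Λ m).filter fun x => x.1 = 0).card +
        ((simplexPoints Λ m).filter fun x => x.2.1 = 0).card +
        ((simplexPoints Λ m).filter fun x => x.2.2 = 0).card +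
        ((simplexPoints Λ m).filter fun x => x.1 + x.2.1 + x.2.2 = m).card := by
  set S₀ := simplexPoints Λ (2 * m)
  set S₁ := S₀.filter (fun x => ¬ m < x.1) with hS₁
  set S₂ := S₁.filter (fun x => ¬ m < x.2.1) with hS₂
  set S₃ := S₂.filter (fun x => ¬ m < x.2.2) with hS₃
  have mem₀ (x : ℤ × ℤ × ℤ) : x ∈ S₀ ↔ _ := mem_simplexPoints
  have a0 := Finset.card_filter_add_card_filter_not (s := S₀) (fun x => m < x.1)
  have a1 := Finset.card_filter_add_card_filter_not (s := S₁) (fun x => m < x.2.1)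
  have a2 := Finset.card_filter_add_card_filter_not (s := S₂) (fun x => m < x.2.2)
  have a3 := Finset.card_filter_add_card_filter_not (s := S₃)
    (fun x => x.1 + x.2.1 + x.2.2 < m)
  have b0 := Finset.card_filter_add_card_filter_not (s := simplexPoints Λ m) (fun x => x.1 = 0)
  have b1 := Finset.card_filter_add_card_filter_not (s := simplexPoints Λ m) (fun x => x.2.1 = 0)
  have b2 := Finset.card_filter_add_card_filter_not (s := simplexPoints Λ m) (fun x => x.2.2 = 0)
  have b3 := Finset.card_filter_add_card_filter_not (s := simplexPoints Λ m)
    (fun x => x.1 + x.2.1 + x.2.2 = m)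
  have c0 : (S₀.filter (fun x => m < x.1)).card =
      ((simplexPoints Λ m).filter fun x => ¬ x.1 = 0).card := by
    refine card_corner h₀ _ _ (fun x hx => ((mem₀ x).1 hx).1) ?_ ?_ <;>
    · rintro ⟨x, y, z⟩ h h'
      simp only [mem₀, mem_simplexPoints, Prod.mk_add_mk, add_zero] at h h' ⊢
      simp only [h', true_and] at h ⊢
      omega
  have c1 : (S₁.filter (fun x => m < x.2.1)).card =
      ((simplexPoints Λ m).filter fun x => ¬ x.2.1 = 0).card := by
    refine card_corner h₁ _ _ (fun x hx => ((mem₀ x).1 (Finset.mem_filter.1 hx).1).1) ?_ ?_ <;>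
    · rintro ⟨x, y, z⟩ h h'
      simp only [hS₁, Finset.mem_filter, mem₀, mem_simplexPoints, Prod.mk_add_mk, add_zero]
        at h h' ⊢
      simp only [h', true_and] at h ⊢
      omega
  have c2 : (S₂.filter (fun x => m < x.2.2)).card =
      ((simplexPoints Λ m).filter fun x => ¬ x.2.2 = 0).card := by
    refine card_corner h₂ _ _ (fun x hx => ((mem₀ x).1 (Finset.mem_filter.1
      (Finset.mem_filter.1 hx).1).1).1) ?_ ?_ <;>
    · rintro ⟨x, y, z⟩ h h'
      simp only [hS₁, hS₂, Finset.mem_filter, mem₀, mem_simplexPoints, Prod.mk_add_mk, add_zero]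
        at h h' ⊢
      simp only [h', true_and] at h ⊢
      omega
  have c3 : S₃.filter (fun x => x.1 + x.2.1 + x.2.2 < m) =
      (simplexPoints Λ m).filter fun x => ¬ x.1 + x.2.1 + x.2.2 = m := by
    ext x
    simp only [hS₁, hS₂, hS₃, Finset.mem_filter, mem₀, mem_simplexPoints]
    by_cases h : x ∈ Λ <;> simp only [h, true_and, false_and]
    omega
  have c4 : S₃.filter (fun x => ¬ x.1 + x.2.1 + x.2.2 < m) = octahedronPoints Λ m := by
    ext x
    simp only [hS₁, hS₂, hS₃, octahedronPoints, Finset.mem_filter, not_lt, and_assoc]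
    rfl
  rw [c0, ← hS₁] at a0
  rw [c1, ← hS₂] at a1
  rw [c2, ← hS₃] at a2
  rw [c3, c4] at a3
  omega

theorem card_face {Λ : AddSubgroup (ℤ × ℤ × ℤ)} {Q : AddSubgroup (ℤ × ℤ)} {m : ℤ}
    (p : ℤ × ℤ × ℤ → Prop) [DecidablePred p] (f : ℤ × ℤ → ℤ × ℤ × ℤ) (g : ℤ × ℤ × ℤ → ℤ × ℤ)
    (hgf : ∀ x, g (f x) = x) (hfg : ∀ x, p x → f (g x) = x) (hf : ∀ x, f x ∈ Λ ↔ x ∈ Q)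
    (h : ∀ x : ℤ × ℤ, (p (f x) ∧ 0 ≤ (f x).1 ∧ 0 ≤ (f x).2.1 ∧ 0 ≤ (f x).2.2 ∧
      (f x).1 + (f x).2.1 + (f x).2.2 ≤ m) ↔ 0 ≤ x.1 ∧ 0 ≤ x.2 ∧ x.1 + x.2 ≤ m) :
    ((simplexPoints Λ m).filter p).card = (trianglePoints Q m).card := by
  have key (x : ℤ × ℤ) : f x ∈ (simplexPoints Λ m).filter p ↔ x ∈ trianglePoints Q m := by
    rw [Finset.mem_filter, mem_simplexPoints, mem_trianglePoints, ← h, ← hf]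
    tauto
  refine Finset.card_nbij' g f ?_ ?_ ?_ ?_
  · intro x hx
    rw [Finset.mem_coe, ← key, hfg x (Finset.mem_filter.1 hx).2]
    exact hx
  · intro x hx
    rw [Finset.mem_coe, key]
    exact hx
  · intro x hx
    exact hfg x (Finset.mem_filter.1 hx).2
  · intro x _
    exact hgf x

/-- The sum over the edges of the simplex of the numbers of points of `Λ` in the half-open
edges. -/
noncomputable def edgeCount (Λ : AddSubgroup (ℤ × ℤ × ℤ)) (N : ℤ) : ℕ :=
  intervalCount (fun x => (x, 0, 0) ∈ Λ) N + intervalCount (fun x => (0, x, 0) ∈ Λ) N +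
    intervalCount (fun x => (0, 0, x) ∈ Λ) N + intervalCount (fun x => (x, -x, 0) ∈ Λ) N +
    intervalCount (fun x => (x, 0, -x) ∈ Λ) N + intervalCount (fun x => (0, x, -x) ∈ Λ) N

/-- Each facet is a triangle over a planar subgroup. Its edges enter the linear term with weight one
half, and each edge belongs to two facets. -/
theorem exists_card_faces {Λ : AddSubgroup (ℤ × ℤ × ℤ)} {N : ℤ} (h : ContainsMultiples Λ N) :
    ∃ c : ℚ, ∀ t : ℕ,
        ((((simplexPoints Λ (N * t)).filter fun x => x.1 = 0).card : ℕ) : ℚ) +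
        (((simplexPoints Λ (N * t)).filter fun x => x.2.1 = 0).card : ℕ) +
        (((simplexPoints Λ (N * t)).filter fun x => x.2.2 = 0).card : ℕ) +
        (((simplexPoints Λ (N * t)).filter fun x => x.1 + x.2.1 + x.2.2 = N * t).card : ℕ) =
      c * t ^ 2 + edgeCount Λ N * t + 4 := by
  let Q₀ : AddSubgroup (ℤ × ℤ) := Λ.comap
    (AddMonoidHom.mk' (fun x => (0, x.1, x.2)) (fun x y => by ext <;> simp))
  let Q₁ : AddSubgroup (ℤ × ℤ) := Λ.comap
    (AddMonoidHom.mk' (fun x => (x.1, 0, x.2)) (fun x y => by simp))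
  let Q₂ : AddSubgroup (ℤ × ℤ) := Λ.comap
    (AddMonoidHom.mk' (fun x => (x.1, x.2, 0)) (fun x y => by simp))
  -- The slanted facet is translated into the parallel plane through the origin, by a multiple of
  -- `(0, 0, N)`.
  let Q₃ : AddSubgroup (ℤ × ℤ) := Λ.comap
    (AddMonoidHom.mk' (fun x => (x.1, x.2, -x.1 - x.2)) (fun x y => by ext <;> simp; ring))
  have m₀ (x y : ℤ) : (x, y) ∈ Q₀ ↔ (0, x, y) ∈ Λ := Iff.rfl
  have m₁ (x y : ℤ) : (x, y) ∈ Q₁ ↔ (x, 0, y) ∈ Λ := Iff.rfl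
  have m₂ (x y : ℤ) : (x, y) ∈ Q₂ ↔ (x, y, 0) ∈ Λ := Iff.rfl
  have m₃ (x y : ℤ) : (x, y) ∈ Q₃ ↔ (x, y, -x - y) ∈ Λ := Iff.rfl
  have n0 : (N, 0, -N) ∈ Λ := by simpa using Λ.sub_mem h.mem₀ h.mem₂
  have n1 : (0, N, -N) ∈ Λ := by simpa using Λ.sub_mem h.mem₁ h.mem₂
  obtain ⟨c₀, h₀⟩ := exists_card_trianglePoints (Q := Q₀) h.pos h.mem₁ h.mem₂
  obtain ⟨c₁, h₁⟩ := exists_card_trianglePoints (Q := Q₁) h.pos h.mem₀ h.mem₂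
  obtain ⟨c₂, h₂⟩ := exists_card_trianglePoints (Q := Q₂) h.pos h.mem₀ h.mem₁
  obtain ⟨c₃, h₃⟩ := exists_card_trianglePoints (Q := Q₃) h.pos
    (by simpa [m₃] using n0) (by simpa [m₃] using n1)
  refine ⟨c₀ + c₁ + c₂ + c₃, fun t => ?_⟩
  rw [card_face (Q := Q₀) (fun x => x.1 = 0) (fun x => (0, x.1, x.2)) (fun x => x.2),
    card_face (Q := Q₁) (fun x => x.2.1 = 0) (fun x => (x.1, 0, x.2)) (fun x => (x.1, x.2.2)),
    card_face (Q := Q₂) (fun x => x.2.2 = 0) (fun x => (x.1, x.2, 0)) (fun x => (x.1, x.2.1)),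
    card_face (Q := Q₃) (fun x => x.1 + x.2.1 + x.2.2 = N * t)
      (fun x => (x.1, x.2, N * t - x.1 - x.2)) (fun x => (x.1, x.2.1)), h₀, h₁, h₂, h₃]
  · simp only [m₀, m₁, m₂, m₃, edgeCount]
    simp only [neg_zero, sub_zero, zero_sub, sub_neg_eq_add, neg_add_cancel, Nat.cast_add]
    ring
  · intro x
    rfl
  · rintro ⟨x, y, z⟩ hx
    simp only [Prod.mk.injEq, true_and] at hx ⊢
    omega
  · rintro ⟨x, y⟩
    rw [m₃]
    have := h.add_mul_mem_iff x y (-x - y) 0 0 t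
    rw [← this]
    simp only [mul_zero, add_zero]
    rw [show N * (t : ℤ) - x - y = -x - y + N * t by ring]
  · rintro ⟨x, y⟩
    simp only
    omega
  · intro x
    rfl
  · rintro ⟨x, y, z⟩ hx
    simp only at hx
    rw [hx]
  · intro x
    rfl
  · rintro ⟨x, y⟩
    simp
  · intro x
    rfl
  · rintro ⟨x, y, z⟩ hx
    simp only at hx
    rw [hx]
  · intro x
    rfl
  · rintro ⟨x, y⟩
    simp
  · intro x
    rfl
  · rintro ⟨x, y, z⟩ hx
    simp only at hx
    rw [hx]
  · intro x
    rfl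
  · rintro ⟨x, y⟩
    simp

/-- The lattice point counts of the simplex and the octahedron are cubic polynomials, and their
linear coefficients are related through the edges of the simplex. -/
theorem exists_card_simplexPoints_octahedronPoints {Λ : AddSubgroup (ℤ × ℤ × ℤ)} {N : ℤ}
    (h : ContainsMultiples Λ N) : ∃ μ₁ μ₂ ν₁ ν₂ : ℚ,
      (∀ t : ℕ, ((simplexPoints Λ (N * t)).card : ℚ) =
        (boxPoints Λ N).card / 6 * (t : ℚ) ^ 3 + μ₁ * (t : ℚ) ^ 2 + μ₂ * t + 1) ∧
      (∀ t : ℕ, ((octahedronPoints Λ (N * t)).card : ℚ) =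
        4 * ((boxPoints Λ N).card / 6) * (t : ℚ) ^ 3 + ν₁ * (t : ℚ) ^ 2 + ν₂ * t + 1) ∧
      ν₂ + 2 * μ₂ = edgeCount Λ N := by
  obtain ⟨μ₁, μ₂, hμ⟩ := exists_card_simplexPoints h
  obtain ⟨c, hc⟩ := exists_card_faces h
  -- These are the coefficients of `L_T(2t) - 4 L_T(t) + F(t)`: the quadratic terms `4μ₁ - 4μ₁`
  -- cancel, and the linear one is `2μ₂ - 4μ₂` plus the edges.
  refine ⟨μ₁, μ₂, c, edgeCount Λ N - 2 * μ₂, hμ, fun t => ?_, by ring⟩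
  have ho := card_octahedronPoints (Λ := Λ) (m := N * t) (mul_nonneg h.pos.le (by positivity))
    (by simpa using h.mul_mem t 0 0) (by simpa using h.mul_mem 0 t 0)
    (by simpa using h.mul_mem 0 0 t)
  have h2 := hμ (2 * t)
  have e : N * ((2 * t : ℕ) : ℤ) = 2 * (N * t) := by push_cast; ring
  rw [e] at h2
  have ho' := congrArg (Nat.cast : ℕ → ℚ) ho
  push_cast at ho' h2
  rw [h2, hμ] at ho'
  linarith [hc t]

/-! ### Lattice points on a segment -/

theorem gcd3_neg (v : Fin 3 → ℤ) : gcd3 (-v) = gcd3 v := by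
  simp [gcd3]

theorem gcd3_dvd (v : Fin 3 → ℤ) (i : Fin 3) : (gcd3 v : ℤ) ∣ v i := by
  have h := Int.gcd_dvd_right (v 0) (Int.gcd (v 1) (v 2))
  fin_cases i
  · exact Int.gcd_dvd_left _ _
  · exact h.trans (Int.gcd_dvd_left _ _)
  · exact h.trans (Int.gcd_dvd_right _ _)

theorem dvd_mul_gcd3 {v : Fin 3 → ℤ} {n x : ℤ} (h : ∀ i, n ∣ x * v i) : n ∣ x * gcd3 v := by
  have h1 : n ∣ x * Int.gcd (v 1) (v 2) := by
    have := Int.dvd_coe_gcd (h 1) (h 2)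
    rw [Int.gcd_mul_left, Nat.cast_mul, Int.natCast_natAbs] at this
    rwa [← dvd_abs, abs_mul, Nat.abs_cast]
  have := Int.dvd_coe_gcd (h 0) h1
  rw [Int.gcd_mul_left, Nat.cast_mul, Int.natCast_natAbs] at this
  rwa [← dvd_abs, abs_mul, Nat.abs_cast]

/-- The number of lattice points on the half-open segment from `0` to `v` is `gcd3 v`. -/
theorem intervalCount_segment {v : Fin 3 → ℤ} {N : ℤ} (hN : 0 < N) (hv : v ⬝ᵥ v = N) :
    intervalCount (fun x => ∃ z : Fin 3 → ℤ, N • z = x • v) N = gcd3 v := by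
  classical
  have hdvd : (gcd3 v : ℤ) ∣ N := by
    rw [← hv]
    exact Finset.dvd_sum fun i _ => (gcd3_dvd v i).mul_right _
  -- The parameters `x` giving a lattice point are the multiples of `m = N / gcd3 v`, so there are
  -- `gcd3 v` of them in a half-open interval of length `N`.
  obtain ⟨m, hm⟩ := hdvd
  have hg : (0 : ℤ) < gcd3 v := by
    refine lt_of_le_of_ne (by positivity) fun h => ?_
    rw [← h, zero_mul] at hm
    omega
  have hm0 : 0 < m := pos_of_mul_pos_right (hm ▸ hN) hg.le
  have hiff (x : ℤ) : (∃ z : Fin 3 → ℤ, N • z = x • v) ↔ m ∣ x := by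
    constructor
    · rintro ⟨z, hz⟩
      have : N ∣ x * gcd3 v := dvd_mul_gcd3 fun i => ⟨z i, (congrFun hz i).symm⟩
      rw [hm, mul_comm] at this
      exact Int.dvd_of_mul_dvd_mul_right hg.ne' this
    · rintro ⟨k, rfl⟩
      choose w hw using gcd3_dvd v
      refine ⟨fun i => k * w i, funext fun i => ?_⟩
      simp only [Pi.smul_apply, smul_eq_mul]
      rw [hw i, hm]
      ring
  have h1 : intervalCount (fun x => m ∣ x) m = 1 := by
    rw [intervalCount, Finset.card_eq_one]
    refine ⟨0, ?_⟩
    ext x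
    simp only [Finset.mem_filter, Finset.mem_Ico, Finset.mem_singleton]
    constructor
    · rintro ⟨⟨h0, h1⟩, h2⟩
      exact Int.eq_zero_of_dvd_of_nonneg_of_lt h0 h1 h2
    · rintro rfl
      simpa using hm0
  have := intervalCount_mul (p := fun x => m ∣ x) hm0 (fun x => by simp) (gcd3 v)
  rw [h1, mul_comm, ← hm] at this
  simp only [hiff]
  exact_mod_cast this.trans (mul_one _)

/-! ### The cube in scaled barycentric coordinates -/

variable {ℓ : ℕ} {a : Matrix (Fin 3) (Fin 3) ℤ}

/-- The barycentric coordinates, scaled by `2 ℓ²`, with respect to the tetrahedron at the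
origin. -/
def baryCoord (a : Matrix (Fin 3) (Fin 3) ℤ) : (Fin 3 → ℤ) →+ ℤ × ℤ × ℤ :=
  AddMonoidHom.mk' (fun z => (a 1 ⬝ᵥ z + a 2 ⬝ᵥ z - a 0 ⬝ᵥ z, a 0 ⬝ᵥ z + a 2 ⬝ᵥ z - a 1 ⬝ᵥ z,
    a 0 ⬝ᵥ z + a 1 ⬝ᵥ z - a 2 ⬝ᵥ z)) (fun z w => by
      simp only [dotProduct_add, Prod.mk_add_mk, Prod.mk.injEq]
      refine ⟨?_, ?_, ?_⟩ <;> ring)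

theorem baryCoord_apply (a : Matrix (Fin 3) (Fin 3) ℤ) (z : Fin 3 → ℤ) :
    baryCoord a z = (a 1 ⬝ᵥ z + a 2 ⬝ᵥ z - a 0 ⬝ᵥ z, a 0 ⬝ᵥ z + a 2 ⬝ᵥ z - a 1 ⬝ᵥ z,
    a 0 ⬝ᵥ z + a 1 ⬝ᵥ z - a 2 ⬝ᵥ z) := rfl

theorem IsCubeMatrix.mul_transpose (ha : IsCubeMatrix ℓ a) :
    a * a.transpose = (ℓ : ℤ) ^ 2 • (1 : Matrix (Fin 3) (Fin 3) ℤ) := by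
  ext i j
  rw [Matrix.mul_apply', Matrix.smul_apply, Matrix.one_apply, smul_ite, smul_zero, smul_eq_mul,
    mul_one]
  exact ha i j

theorem IsCubeMatrix.natAbs_det (ha : IsCubeMatrix ℓ a) : a.det.natAbs = ℓ ^ 3 := by
  have h := congrArg Matrix.det ha.mul_transpose
  rw [Matrix.det_mul, Matrix.det_transpose, Matrix.det_smul, Matrix.det_one, Fintype.card_fin,
    mul_one] at h
  have : a.det.natAbs = ((ℓ : ℤ) ^ 3).natAbs := by
    rw [Int.natAbs_eq_iff_sq_eq]
    linear_combination h
  rw [this]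
  simp [Int.natAbs_pow]

/-- A left inverse is also a right inverse; over `ℤ` the factor `a` is cancelled by multiplying with
the adjugate and dividing by the nonzero determinant. -/
theorem IsCubeMatrix.transpose_mul (hℓ : 0 < ℓ) (ha : IsCubeMatrix ℓ a) :
    a.transpose * a = (ℓ : ℤ) ^ 2 • (1 : Matrix (Fin 3) (Fin 3) ℤ) := by
  have hd : a.det ≠ 0 := by
    rw [← Int.natAbs_ne_zero, ha.natAbs_det]
    positivity
  have h : a.adjugate * (a * (a.transpose * a)) =
      a.adjugate * (a * ((ℓ : ℤ) ^ 2 • (1 : Matrix (Fin 3) (Fin 3) ℤ))) := by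
    rw [← mul_assoc a, ha.mul_transpose, smul_mul_assoc, one_mul, mul_smul_comm, mul_smul_comm,
      mul_smul_comm, mul_one]
  rw [← mul_assoc a.adjugate, ← mul_assoc a.adjugate, Matrix.adjugate_mul, smul_mul_assoc, smul_mul_assoc, one_mul,
    one_mul] at h
  exact smul_right_injective _ hd h

theorem IsCubeMatrix.sum_dotProduct_smul (hℓ : 0 < ℓ) (ha : IsCubeMatrix ℓ a)
    (z : Fin 3 → ℤ) :
    (a 0 ⬝ᵥ z) • a 0 + (a 1 ⬝ᵥ z) • a 1 + (a 2 ⬝ᵥ z) • a 2 = (ℓ : ℤ) ^ 2 • z := by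
  have h := congrArg (fun M => Matrix.mulVec M z) (ha.transpose_mul hℓ)
  simp only [← Matrix.mulVec_mulVec, Matrix.smul_mulVec, Matrix.one_mulVec] at h
  rw [← h]
  ext i
  simp only [Matrix.mulVec, dotProduct, Fin.sum_univ_three, Matrix.transpose_apply, Pi.add_apply,
    Pi.smul_apply, smul_eq_mul]
  ring

theorem IsCubeMatrix.dotProduct_self (ha : IsCubeMatrix ℓ a) (i : Fin 3) :
    a i ⬝ᵥ a i = (ℓ : ℤ) ^ 2 := by
  rw [ha, if_pos rfl]

theorem IsCubeMatrix.dotProduct_of_ne (ha : IsCubeMatrix ℓ a) {i j : Fin 3} (h : i ≠ j) :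
    a i ⬝ᵥ a j = 0 := by
  rw [ha, if_neg h]

/-- The integral combination of the edges at the origin of the tetrahedron. -/
def edgeCombination (a : Matrix (Fin 3) (Fin 3) ℤ) (x : ℤ × ℤ × ℤ) : Fin 3 → ℤ :=
  x.1 • (a 1 + a 2) + x.2.1 • (a 0 + a 2) + x.2.2 • (a 0 + a 1)

/-- With `baryCoord_edgeCombination`, this makes the two maps inverse up to the factor `2ℓ²`.
Injectivity, the description of the range and the inclusion of `2ℓ² ℤ³` in it all follow. -/
theorem edgeCombination_baryCoord (hℓ : 0 < ℓ) (ha : IsCubeMatrix ℓ a) (z : Fin 3 → ℤ) :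
    edgeCombination a (baryCoord a z) = (2 * (ℓ : ℤ) ^ 2) • z := by
  rw [mul_smul, ← ha.sum_dotProduct_smul hℓ z, edgeCombination, baryCoord_apply]
  ext i
  simp only [Pi.add_apply, Pi.smul_apply, smul_eq_mul]
  ring

theorem baryCoord_edgeCombination (ha : IsCubeMatrix ℓ a) (x : ℤ × ℤ × ℤ) :
    baryCoord a (edgeCombination a x) = (2 * (ℓ : ℤ) ^ 2) • x := by
  rw [baryCoord_apply, edgeCombination]
  simp only [dotProduct_add, dotProduct_smul, ha.dotProduct_self, smul_eq_mul,
    ha.dotProduct_of_ne (show (0 : Fin 3) ≠ 1 by decide),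
    ha.dotProduct_of_ne (show (0 : Fin 3) ≠ 2 by decide),
    ha.dotProduct_of_ne (show (1 : Fin 3) ≠ 0 by decide),
    ha.dotProduct_of_ne (show (1 : Fin 3) ≠ 2 by decide),
    ha.dotProduct_of_ne (show (2 : Fin 3) ≠ 0 by decide),
    ha.dotProduct_of_ne (show (2 : Fin 3) ≠ 1 by decide)]
  ext <;> simp only [Prod.smul_fst, Prod.smul_snd, smul_eq_mul] <;> ring

theorem baryCoord_injective (hℓ : 0 < ℓ) (ha : IsCubeMatrix ℓ a) :
    Function.Injective (baryCoord a) := by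
  intro z w h
  have := edgeCombination_baryCoord hℓ ha z
  rw [h, edgeCombination_baryCoord hℓ ha w] at this
  exact (smul_right_injective (Fin 3 → ℤ) (r := 2 * (ℓ : ℤ) ^ 2) (by positivity) this).symm

theorem mem_range_baryCoord (hℓ : 0 < ℓ) (ha : IsCubeMatrix ℓ a) (x : ℤ × ℤ × ℤ) :
    x ∈ (baryCoord a).range ↔ ∃ z : Fin 3 → ℤ, (2 * (ℓ : ℤ) ^ 2) • z = edgeCombination a x := by
  rw [AddMonoidHom.mem_range]
  refine exists_congr fun z => ⟨?_, fun h => ?_⟩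
  · rintro rfl
    exact (edgeCombination_baryCoord hℓ ha z).symm
  · have h1 := baryCoord_edgeCombination ha x
    rw [← h, map_zsmul] at h1
    exact smul_right_injective (ℤ × ℤ × ℤ) (r := 2 * (ℓ : ℤ) ^ 2) (by positivity) h1

theorem containsMultiples_range_baryCoord (hℓ : 0 < ℓ) (ha : IsCubeMatrix ℓ a) :
    ContainsMultiples (baryCoord a).range (2 * (ℓ : ℤ) ^ 2) where
  pos := by positivity
  mem₀ := ⟨_, (baryCoord_edgeCombination ha (1, 0, 0)).trans (by simp)⟩
  mem₁ := ⟨_, (baryCoord_edgeCombination ha (0, 1, 0)).trans (by simp)⟩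
  mem₂ := ⟨_, (baryCoord_edgeCombination ha (0, 0, 1)).trans (by simp)⟩

theorem IsCubeMatrix.add_dotProduct_self (ha : IsCubeMatrix ℓ a) {i j : Fin 3} (h : i ≠ j) :
    (a i + a j) ⬝ᵥ (a i + a j) = 2 * (ℓ : ℤ) ^ 2 := by
  simp only [add_dotProduct, dotProduct_add, ha.dotProduct_self, ha.dotProduct_of_ne h,
    ha.dotProduct_of_ne h.symm]
  ring

theorem IsCubeMatrix.sub_dotProduct_self (ha : IsCubeMatrix ℓ a) {i j : Fin 3} (h : i ≠ j) :
    (a i - a j) ⬝ᵥ (a i - a j) = 2 * (ℓ : ℤ) ^ 2 := by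
  simp only [sub_dotProduct, dotProduct_sub, ha.dotProduct_self, ha.dotProduct_of_ne h,
    ha.dotProduct_of_ne h.symm]
  ring

theorem edgeCount_range_baryCoord (hℓ : 0 < ℓ) (ha : IsCubeMatrix ℓ a) :
    edgeCount (baryCoord a).range (2 * (ℓ : ℤ) ^ 2) =
      gcd3 (a 0 + a 1) + gcd3 (a 0 + a 2) + gcd3 (a 1 + a 2) + gcd3 (a 0 - a 1) +
        gcd3 (a 0 - a 2) + gcd3 (a 2 - a 1) := by
  have hN : 0 < 2 * (ℓ : ℤ) ^ 2 := by positivity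
  -- Every edge of the tetrahedron is a face diagonal of the cube, so its squared length is exactly
  -- the period `2ℓ²`, as `intervalCount_segment` requires.
  have key (d : ℤ → ℤ × ℤ × ℤ) (v : Fin 3 → ℤ) (hd : ∀ x, edgeCombination a (d x) = x • v)
      (hv : v ⬝ᵥ v = 2 * (ℓ : ℤ) ^ 2) :
      intervalCount (fun x => d x ∈ (baryCoord a).range) (2 * (ℓ : ℤ) ^ 2) = gcd3 v := by
    simp only [mem_range_baryCoord hℓ ha, hd]
    exact intervalCount_segment hN hv
  rw [edgeCount, key (fun x => (x, 0, 0)) (a 1 + a 2) (fun x => by simp [edgeCombination])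
      (ha.add_dotProduct_self (by decide)),
    key (fun x => (0, x, 0)) (a 0 + a 2) (fun x => by simp [edgeCombination])
      (ha.add_dotProduct_self (by decide)),
    key (fun x => (0, 0, x)) (a 0 + a 1) (fun x => by simp [edgeCombination])
      (ha.add_dotProduct_self (by decide)),
    key (fun x => (x, -x, 0)) (a 1 - a 0) (fun x => by simp only [edgeCombination]; module)
      (ha.sub_dotProduct_self (by decide)),
    key (fun x => (x, 0, -x)) (a 2 - a 0) (fun x => by simp only [edgeCombination]; module)
      (ha.sub_dotProduct_self (by decide)),
    key (fun x => (0, x, -x)) (a 2 - a 1) (fun x => by simp only [edgeCombination]; module)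
      (ha.sub_dotProduct_self (by decide)), ← gcd3_neg (a 1 - a 0), ← gcd3_neg (a 2 - a 0),
    neg_sub, neg_sub]
  ring

/-- Points of the box represent `Λ` modulo `Nℤ³`, that is, `ℤ³` modulo the lattice spanned by the
three edges of the tetrahedron at the origin. Its index is the absolute determinant of the edge
matrix, twice that of `a`. -/
theorem card_boxPoints_range_baryCoord (hℓ : 0 < ℓ) (ha : IsCubeMatrix ℓ a) :
    (boxPoints (baryCoord a).range (2 * (ℓ : ℤ) ^ 2)).card = 2 * ℓ ^ 3 := by
  have hN : 0 < 2 * (ℓ : ℤ) ^ 2 := by positivity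
  set N := 2 * (ℓ : ℤ) ^ 2 with hNdef
  let E : Matrix (Fin 3) (Fin 3) ℤ := Matrix.of ![a 1 + a 2, a 0 + a 2, a 0 + a 1]
  let f : (Fin 3 → ℤ) →ₗ[ℤ] (Fin 3 → ℤ) := Matrix.toLin' E.transpose
  have hf (n : Fin 3 → ℤ) : f n = edgeCombination a (n 0, n 1, n 2) := by
    ext i
    simp only [f, E, Matrix.toLin'_apply, Matrix.mulVec, dotProduct, Fin.sum_univ_three,
      Matrix.transpose_apply, edgeCombination, Pi.add_apply, Pi.smul_apply, smul_eq_mul,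
      Matrix.of_apply]
    simp [mul_comm]
  have hdet : (LinearMap.det f).natAbs = 2 * ℓ ^ 3 := by
    have : E.det = 2 * a.det := by
      simp only [Matrix.det_fin_three, E, Matrix.of_apply]
      simp
      ring
    rw [LinearMap.det_toLin', Matrix.det_transpose, this, Int.natAbs_mul, ha.natAbs_det]
    rfl
  have hinj : Function.Injective f := by
    refine Matrix.mulVec_injective_of_det_ne_zero fun h => ?_
    rw [← LinearMap.det_toLin'] at h
    have : (0 : ℕ) < 2 * ℓ ^ 3 := by positivity
    rw [← hdet, h] at this
    exact lt_irrefl _ this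
  have hcard : Nat.card ((Fin 3 → ℤ) ⧸ LinearMap.range f) = 2 * ℓ ^ 3 := by
    rw [← hdet, ← Submodule.natAbs_det_equiv (LinearMap.range f) (LinearEquiv.ofInjective f hinj)]
    rfl
  have hmem (x : boxPoints (baryCoord a).range N) : ∃ z, baryCoord a z = x :=
    (mem_boxPoints.1 x.2).1
  choose g hg using hmem
  rw [← hcard, ← Fintype.card_coe, ← Nat.card_eq_fintype_card]
  refine Nat.card_congr (Equiv.ofBijective
    (fun x => (Submodule.Quotient.mk (g x) : (Fin 3 → ℤ) ⧸ LinearMap.range f)) ⟨?_, ?_⟩)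
  · intro x y hxy
    obtain ⟨n, hn⟩ := (Submodule.Quotient.eq _).1 hxy
    have h := congrArg (baryCoord a) hn
    rw [hf, baryCoord_edgeCombination ha, map_sub, hg, hg] at h
    have hx := mem_boxPoints.1 x.2
    have hy := mem_boxPoints.1 y.2
    have eq_of (u v k : ℤ) (hu : 0 ≤ u ∧ u < N) (hv : 0 ≤ v ∧ v < N) (h : N * k = u - v) :
        u = v := by
      have := Int.eq_zero_of_abs_lt_dvd ⟨k, h.symm⟩ (abs_lt.2 ⟨by omega, by omega⟩)
      omega
    have h' := Prod.ext_iff.1 h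
    have h'' := Prod.ext_iff.1 h'.2
    exact Subtype.ext (Prod.ext (eq_of _ _ _ hx.2.1 hy.2.1 h'.1)
      (Prod.ext (eq_of _ _ _ hx.2.2.1 hy.2.2.1 h''.1) (eq_of _ _ _ hx.2.2.2 hy.2.2.2 h''.2)))
  · intro q
    obtain ⟨z, rfl⟩ := Submodule.Quotient.mk_surjective _ q
    set x := baryCoord a z with hx
    have hw : baryCoord a (z - edgeCombination a (x.1 / N, x.2.1 / N, x.2.2 / N)) =
        (x.1 % N, x.2.1 % N, x.2.2 % N) := by
      rw [map_sub, baryCoord_edgeCombination ha, ← hx, ← hNdef]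
      ext <;> simp [Int.emod_def]
    have hb : (x.1 % N, x.2.1 % N, x.2.2 % N) ∈ boxPoints (baryCoord a).range N :=
      mem_boxPoints.2 ⟨⟨_, hw⟩, ⟨Int.emod_nonneg _ hN.ne', Int.emod_lt_of_pos _ hN⟩,
        ⟨Int.emod_nonneg _ hN.ne', Int.emod_lt_of_pos _ hN⟩,
        ⟨Int.emod_nonneg _ hN.ne', Int.emod_lt_of_pos _ hN⟩⟩
    refine ⟨⟨_, hb⟩, (Submodule.Quotient.eq _).2 ?_⟩
    rw [baryCoord_injective hℓ ha ((hg ⟨_, hb⟩).trans hw.symm), sub_sub_cancel_left]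
    exact neg_mem ⟨![x.1 / N, x.2.1 / N, x.2.2 / N], hf _⟩

/-! ### From convex hulls to inequalities in barycentric coordinates -/

theorem toReal3_dotProduct (v w : Fin 3 → ℤ) : toReal3 v ⬝ᵥ toReal3 w = ((v ⬝ᵥ w : ℤ) : ℝ) := by
  simp [dotProduct, toReal3]

theorem toReal3_add (v w : Fin 3 → ℤ) : toReal3 (v + w) = toReal3 v + toReal3 w := by
  ext i
  simp [toReal3]

theorem toReal3_zsmul (n : ℤ) (v : Fin 3 → ℤ) : toReal3 (n • v) = (n : ℝ) • toReal3 v := by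
  ext i
  simp [toReal3]

theorem toReal3_sum {ι : Type*} (s : Finset ι) (v : ι → Fin 3 → ℤ) :
    toReal3 (∑ i ∈ s, v i) = ∑ i ∈ s, toReal3 (v i) := by
  ext j
  simp [toReal3]

/-- An inequality valid at the vertices is valid on the dilates of a lattice polytope. -/
theorem dotProduct_le_of_mem_smul {V : Set (Fin 3 → ℤ)} {c : Fin 3 → ℤ} {b : ℤ}
    (h : ∀ v ∈ V, c ⬝ᵥ v ≤ b) {t : ℕ} {z : Fin 3 → ℤ}
    (hz : toReal3 z ∈ (t : ℝ) • latticePolytope V) : c ⬝ᵥ z ≤ b * t := by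
  have hsub : latticePolytope V ⊆ {y | toReal3 c ⬝ᵥ y ≤ b} := by
    refine convexHull_min ?_ (convex_halfSpace_le
      ⟨dotProduct_add _, fun r y => dotProduct_smul r _ y⟩ _)
    rintro _ ⟨v, hv, rfl⟩
    rw [Set.mem_ofPred_eq, toReal3_dotProduct]
    exact_mod_cast h v hv
  obtain ⟨y, hy, hyz⟩ := hz
  have h1 : toReal3 c ⬝ᵥ y ≤ b := hsub hy
  have h2 : ((c ⬝ᵥ z : ℤ) : ℝ) = t * (toReal3 c ⬝ᵥ y) := by
    rw [← toReal3_dotProduct, ← hyz]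
    simp only [dotProduct_smul, smul_eq_mul]
  have h3 : ((c ⬝ᵥ z : ℤ) : ℝ) ≤ b * t := by
    rw [h2, mul_comm]
    exact mul_le_mul_of_nonneg_right h1 (by positivity)
  exact_mod_cast h3

/-- An integral combination of the vertices gives a point of the dilate. -/
theorem mem_smul_of_sum_eq {ι : Type*} [Fintype ι] {V : Set (Fin 3 → ℤ)} (hV : V.Nonempty)
    (n : ι → ℤ) (v : ι → Fin 3 → ℤ) (hv : ∀ i, v i ∈ V) (hn : ∀ i, 0 ≤ n i) {M : ℤ} (hM : 0 < M)
    {t : ℕ} (hsum : ∑ i, n i = M * t) {z : Fin 3 → ℤ} (hz : M • z = ∑ i, n i • v i) :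
    toReal3 z ∈ (t : ℝ) • latticePolytope V := by
  have hM' : (0 : ℝ) < M := by exact_mod_cast hM
  have hz' : toReal3 z = (M : ℝ)⁻¹ • ∑ i, (n i : ℝ) • toReal3 (v i) := by
    rw [eq_inv_smul_iff₀ hM'.ne', ← toReal3_zsmul, hz, toReal3_sum]
    simp only [toReal3_zsmul]
  -- The convex weights are `n i / (M * t)`, so `t = 0` is separate; there the dilate is the origin
  -- only because `V` is nonempty.
  rcases Nat.eq_zero_or_pos t with rfl | ht
  · have h0 : ∀ i, n i = 0 := by
      simpa [Finset.sum_eq_zero_iff_of_nonneg fun i _ => hn i] using hsum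
    have hne : (latticePolytope V).Nonempty := (hV.image _).convexHull
    rw [hz', Nat.cast_zero, Set.zero_smul_set hne]
    simp [h0]
  · have ht' : (0 : ℝ) < t := by exact_mod_cast ht
    refine ⟨∑ i, ((n i : ℝ) / (M * t)) • toReal3 (v i), ?_, ?_⟩
    · refine (convex_convexHull ℝ _).sum_mem (fun i _ => ?_) ?_ (fun i _ => ?_)
      · have := hn i
        positivity
      · rw [← Finset.sum_div, div_eq_one_iff_eq (by positivity)]
        exact_mod_cast hsum
      · exact subset_convexHull ℝ _ ⟨v i, hv i, rfl⟩
    · simp only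
      rw [hz', Finset.smul_sum, Finset.smul_sum]
      refine Finset.sum_congr rfl fun i _ => ?_
      rw [smul_smul, smul_smul]
      congr 1
      field_simp

theorem mem_smul_image {V : Set (Fin 3 → ℤ)} {t : ℕ} {z : Fin 3 → ℤ} (c : Fin 3 → ℤ) (s : ℤ)
    (hz : toReal3 z ∈ (t : ℝ) • latticePolytope V) :
    toReal3 ((t : ℤ) • c + s • z) ∈ (t : ℝ) • latticePolytope ((fun v => c + s • v) '' V) := by
  obtain ⟨y, hy, hyz⟩ := hz
  refine ⟨toReal3 c + (s : ℝ) • y, ?_, ?_⟩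
  · have hsub : latticePolytope V ⊆ ((fun y => toReal3 c + y) ∘ ((s : ℝ) • ·)) ⁻¹'
        latticePolytope ((fun v => c + s • v) '' V) := by
      refine convexHull_min ?_ ?_
      · rintro _ ⟨v, hv, rfl⟩
        refine subset_convexHull ℝ _ ⟨c + s • v, ⟨v, hv, rfl⟩, ?_⟩
        rw [toReal3_add, toReal3_zsmul]
        rfl
      · rw [Set.preimage_comp]
        exact ((convex_convexHull ℝ _).translate_preimage_right _).smul_preimage _
    exact hsub hy
  · rw [toReal3_add, toReal3_zsmul, toReal3_zsmul, ← hyz]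
    simp only [smul_add]
    rw [smul_comm]
    simp

/-- Since `s = ±1`, the map `z ↦ t c + s z` permutes `ℤ³`, and its inverse has the same form. This
lets one tetrahedron and one octahedron stand for both. -/
theorem latticeCount_image (V : Set (Fin 3 → ℤ)) (c : Fin 3 → ℤ) {s : ℤ} (hs : s * s = 1)
    (t : ℕ) : latticeCount (latticePolytope ((fun v => c + s • v) '' V)) t =
      latticeCount (latticePolytope V) t := by
  have hinv (k z : Fin 3 → ℤ) : -(s • k) + s • (k + s • z) = z := by
    rw [smul_add, smul_smul, hs, one_smul, neg_add_cancel_left]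
  have hinv' (k z : Fin 3 → ℤ) : k + s • (-(s • k) + s • z) = z := by
    rw [smul_add, smul_neg, smul_smul, smul_smul, hs, one_smul, one_smul, add_neg_cancel_left]
  have himg : (fun v => -(s • c) + s • v) '' ((fun v => c + s • v) '' V) = V := by
    rw [Set.image_image]
    simp only [hinv, Set.image_id']
  refine (Set.ncard_congr (fun z _ => (t : ℤ) • c + s • z) (fun z hz => mem_smul_image c s hz)
    ?_ ?_).symm
  · intro z w _ _ h
    rw [← hinv ((t : ℤ) • c) z, h, hinv]
  · intro w hw
    refine ⟨-(s • (t : ℤ) • c) + s • w, ?_, hinv' _ _⟩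
    have := mem_smul_image (-(s • c)) s hw
    rwa [himg, smul_neg, smul_comm] at this

theorem ncard_setOf_baryCoord_mem (hℓ : 0 < ℓ) (ha : IsCubeMatrix ℓ a) {S : Finset (ℤ × ℤ × ℤ)}
    (hS : ∀ x ∈ S, x ∈ (baryCoord a).range) : {z | baryCoord a z ∈ S}.ncard = S.card := by
  rw [← Set.ncard_image_of_injective _ (baryCoord_injective hℓ ha), ← Set.ncard_coe_finset]
  congr 1
  ext x
  constructor
  · rintro ⟨z, hz, rfl⟩
    exact hz
  · intro hx
    obtain ⟨z, rfl⟩ := hS x hx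
    exact ⟨z, hx, rfl⟩

/-- Reflection in the centre of the cube exchanges the two inscribed tetrahedra. -/
theorem tetrahedron'_eq (a : Matrix (Fin 3) (Fin 3) ℤ) : tetrahedron' a = latticePolytope
    ((fun v => (a 0 + a 1 + a 2) + (-1 : ℤ) • v) '' {0, a 0 + a 1, a 1 + a 2, a 0 + a 2}) := by
  rw [tetrahedron']
  congr 1
  simp only [Set.image_insert_eq, Set.image_singleton]
  have e0 : a 0 + a 1 + a 2 + (-1 : ℤ) • (0 : Fin 3 → ℤ) = a 0 + a 1 + a 2 := by module
  have e1 : a 0 + a 1 + a 2 + (-1 : ℤ) • (a 0 + a 1) = a 2 := by module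
  have e2 : a 0 + a 1 + a 2 + (-1 : ℤ) • (a 1 + a 2) = a 0 := by module
  have e3 : a 0 + a 1 + a 2 + (-1 : ℤ) • (a 0 + a 2) = a 1 := by module
  rw [e0, e1, e2, e3]
  ext v
  simp only [Set.mem_insert_iff, Set.mem_singleton_iff]
  tauto

theorem octahedron'_eq (a : Matrix (Fin 3) (Fin 3) ℤ) : octahedron' a = latticePolytope
    ((fun v => (a 0 + a 1 + a 2) + (1 : ℤ) • v) '' {a 0, -a 0, a 1, -a 1, a 2, -a 2}) := by
  rw [octahedron']
  congr 1
  simp only [Set.image_insert_eq, Set.image_singleton]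
  have e0 : a 0 + a 1 + a 2 + (1 : ℤ) • a 0 = a 1 + a 2 + 2 • a 0 := by module
  have e1 : a 0 + a 1 + a 2 + (1 : ℤ) • -a 0 = a 1 + a 2 := by module
  have e2 : a 0 + a 1 + a 2 + (1 : ℤ) • a 1 = a 0 + a 2 + 2 • a 1 := by module
  have e3 : a 0 + a 1 + a 2 + (1 : ℤ) • -a 1 = a 0 + a 2 := by module
  have e4 : a 0 + a 1 + a 2 + (1 : ℤ) • a 2 = a 0 + a 1 + 2 • a 2 := by module
  have e5 : a 0 + a 1 + a 2 + (1 : ℤ) • -a 2 = a 0 + a 1 := by module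
  rw [e0, e1, e2, e3, e4, e5]
  ext v
  simp only [Set.mem_insert_iff, Set.mem_singleton_iff]
  tauto

theorem mem_smul_tetrahedron (hℓ : 0 < ℓ) (ha : IsCubeMatrix ℓ a) (t : ℕ) (z : Fin 3 → ℤ) :
    toReal3 z ∈ (t : ℝ) • tetrahedron a ↔
      baryCoord a z ∈ simplexPoints (baryCoord a).range (2 * (ℓ : ℤ) ^ 2 * t) := by
  have h01 := ha.dotProduct_of_ne (show (0 : Fin 3) ≠ 1 by decide)
  have h02 := ha.dotProduct_of_ne (show (0 : Fin 3) ≠ 2 by decide)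
  have h10 := ha.dotProduct_of_ne (show (1 : Fin 3) ≠ 0 by decide)
  have h12 := ha.dotProduct_of_ne (show (1 : Fin 3) ≠ 2 by decide)
  have h20 := ha.dotProduct_of_ne (show (2 : Fin 3) ≠ 0 by decide)
  have h21 := ha.dotProduct_of_ne (show (2 : Fin 3) ≠ 1 by decide)
  have hL : 0 ≤ (ℓ : ℤ) ^ 2 := by positivity
  constructor
  · intro h
    have key (c : Fin 3 → ℤ) (b : ℤ) (h0 : 0 ≤ b) (h1 : c ⬝ᵥ (a 0 + a 1) ≤ b)
        (h2 : c ⬝ᵥ (a 1 + a 2) ≤ b) (h3 : c ⬝ᵥ (a 0 + a 2) ≤ b) : c ⬝ᵥ z ≤ b * t := by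
      refine dotProduct_le_of_mem_smul ?_ h
      rintro v (rfl | rfl | rfl | rfl)
      · simpa using h0
      · exact h1
      · exact h2
      · exact h3
    -- The four facet inequalities, tested at the vertices.
    have k0 := key (a 0 - a 1 - a 2) 0
    have k1 := key (a 1 - a 0 - a 2) 0
    have k2 := key (a 2 - a 0 - a 1) 0
    have k3 := key (a 0 + a 1 + a 2) (2 * (ℓ : ℤ) ^ 2)
    simp only [sub_dotProduct, add_dotProduct, dotProduct_add, ha.dotProduct_self, h01, h02, h10,
      h12, h20, h21] at k0 k1 k2 k3
    rw [mem_simplexPoints, baryCoord_apply]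
    refine ⟨⟨z, rfl⟩, ?_, ?_, ?_, ?_⟩
    · have := k0 (by omega) (by omega) (by omega) (by omega)
      simp only
      omega
    · have := k1 (by omega) (by omega) (by omega) (by omega)
      simp only
      omega
    · have := k2 (by omega) (by omega) (by omega) (by omega)
      simp only
      omega
    · have := k3 (by omega) (by omega) (by omega) (by omega)
      simp only
      omega
  · intro h
    have hz := edgeCombination_baryCoord hℓ ha z
    rw [mem_simplexPoints] at h
    set x := baryCoord a z
    obtain ⟨-, h0, h1, h2, h3⟩ := h
    refine mem_smul_of_sum_eq (M := 2 * (ℓ : ℤ) ^ 2) ⟨0, by simp⟩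
      ![x.1, x.2.1, x.2.2, 2 * (ℓ : ℤ) ^ 2 * t - (x.1 + x.2.1 + x.2.2)]
      ![a 1 + a 2, a 0 + a 2, a 0 + a 1, 0] ?_ ?_ (by positivity) ?_ ?_
    · intro i
      fin_cases i <;> simp
    · intro i
      fin_cases i <;> simp [h0, h1, h2, h3]
    · simp [Fin.sum_univ_four]
    · rw [← hz, edgeCombination]
      ext i
      simp [Fin.sum_univ_four]
      ring

theorem mem_smul_octahedron' (hℓ : 0 < ℓ) (ha : IsCubeMatrix ℓ a) (t : ℕ) (z : Fin 3 → ℤ) :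
    toReal3 z ∈ (t : ℝ) • octahedron' a ↔
      baryCoord a z ∈ octahedronPoints (baryCoord a).range (2 * (ℓ : ℤ) ^ 2 * t) := by
  have h01 := ha.dotProduct_of_ne (show (0 : Fin 3) ≠ 1 by decide)
  have h02 := ha.dotProduct_of_ne (show (0 : Fin 3) ≠ 2 by decide)
  have h10 := ha.dotProduct_of_ne (show (1 : Fin 3) ≠ 0 by decide)
  have h12 := ha.dotProduct_of_ne (show (1 : Fin 3) ≠ 2 by decide)
  have h20 := ha.dotProduct_of_ne (show (2 : Fin 3) ≠ 0 by decide)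
  have h21 := ha.dotProduct_of_ne (show (2 : Fin 3) ≠ 1 by decide)
  have hL : 0 ≤ (ℓ : ℤ) ^ 2 := by positivity
  rw [octahedronPoints, Finset.mem_filter, mem_simplexPoints, baryCoord_apply]
  set p := a 0 ⬝ᵥ z with hp
  set q := a 1 ⬝ᵥ z with hq
  set r := a 2 ⬝ᵥ z with hr
  simp only
  constructor
  · intro h
    have key (c : Fin 3 → ℤ) (b : ℤ) (h0 : c ⬝ᵥ (a 0 + a 1) ≤ b) (h1 : c ⬝ᵥ (a 0 + a 2) ≤ b)
        (h2 : c ⬝ᵥ (a 1 + a 2) ≤ b) (h3 : c ⬝ᵥ (a 0 + a 1 + 2 • a 2) ≤ b)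
        (h4 : c ⬝ᵥ (a 0 + a 2 + 2 • a 1) ≤ b) (h5 : c ⬝ᵥ (a 1 + a 2 + 2 • a 0) ≤ b) :
        c ⬝ᵥ z ≤ b * t := by
      refine dotProduct_le_of_mem_smul ?_ h
      rintro v (rfl | rfl | rfl | rfl | rfl | rfl) <;> assumption
    -- The eight facets: `k0` to `k3` are those of the doubled tetrahedron, `k4` to `k7` cut off its
    -- corners.
    have k0 := key (a 0 - a 1 - a 2) 0
    have k1 := key (a 1 - a 0 - a 2) 0
    have k2 := key (a 2 - a 0 - a 1) 0
    have k3 := key (a 0 + a 1 + a 2) (4 * (ℓ : ℤ) ^ 2)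
    have k4 := key (a 1 + a 2 - a 0) (2 * (ℓ : ℤ) ^ 2)
    have k5 := key (a 0 + a 2 - a 1) (2 * (ℓ : ℤ) ^ 2)
    have k6 := key (a 0 + a 1 - a 2) (2 * (ℓ : ℤ) ^ 2)
    have k7 := key (-(a 0 + a 1 + a 2)) (-(2 * (ℓ : ℤ) ^ 2))
    simp only [neg_dotProduct, sub_dotProduct, add_dotProduct, dotProduct_add, two_nsmul,
      ha.dotProduct_self, h01, h02, h10, h12, h20, h21, ← hp, ← hq, ← hr] at k0 k1 k2 k3 k4 k5 k6 k7
    have k0 := k0 (by omega) (by omega) (by omega) (by omega) (by omega) (by omega)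
    have k1 := k1 (by omega) (by omega) (by omega) (by omega) (by omega) (by omega)
    have k2 := k2 (by omega) (by omega) (by omega) (by omega) (by omega) (by omega)
    have k3 := k3 (by omega) (by omega) (by omega) (by omega) (by omega) (by omega)
    have k4 := k4 (by omega) (by omega) (by omega) (by omega) (by omega) (by omega)
    have k5 := k5 (by omega) (by omega) (by omega) (by omega) (by omega) (by omega)
    have k6 := k6 (by omega) (by omega) (by omega) (by omega) (by omega) (by omega)
    have k7 := k7 (by omega) (by omega) (by omega) (by omega) (by omega) (by omega)
    exact ⟨⟨⟨z, rfl⟩, by linarith, by linarith, by linarith, by linarith⟩, by linarith,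
      by linarith, by linarith, by linarith⟩
  · rintro ⟨⟨-, h0, h1, h2, h3⟩, h4, h5, h6, h7⟩
    have hz := ha.sum_dotProduct_smul hℓ z
    rw [← hp, ← hq, ← hr] at hz
    clear_value p q r
    obtain ⟨m, hm⟩ : ∃ m : ℤ, m = (ℓ : ℤ) ^ 2 * t := ⟨_, rfl⟩
    -- Relative to the centre of the dilate, `z` has coordinates `p - m`, `q - m`, `r - m` (scaled
    -- by `ℓ²`). They are split into positive and negative parts, and the eight inequalities bound
    -- the sum of their absolute values by `m`.
    rw [mul_assoc, ← hm] at h3 h4 h5 h6 h7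
    obtain ⟨p₁, p₂, hp₁, hp₂, hpe, hpa⟩ : ∃ u v : ℤ, 0 ≤ u ∧ 0 ≤ v ∧ u - v = p - m ∧
        (u = 0 ∨ v = 0) := ⟨max (p - m) 0, max (-(p - m)) 0, by omega, by omega, by omega, by omega⟩
    obtain ⟨q₁, q₂, hq₁, hq₂, hqe, hqa⟩ : ∃ u v : ℤ, 0 ≤ u ∧ 0 ≤ v ∧ u - v = q - m ∧
        (u = 0 ∨ v = 0) := ⟨max (q - m) 0, max (-(q - m)) 0, by omega, by omega, by omega, by omega⟩
    obtain ⟨r₁, r₂, hr₁, hr₂, hre, hra⟩ : ∃ u v : ℤ, 0 ≤ u ∧ 0 ≤ v ∧ u - v = r - m ∧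
        (u = 0 ∨ v = 0) := ⟨max (r - m) 0, max (-(r - m)) 0, by omega, by omega, by omega, by omega⟩
    obtain ⟨k, hk⟩ : ∃ k : ℤ, k = m - (p₁ + p₂) - (q₁ + q₂) - (r₁ + r₂) := ⟨_, rfl⟩
    have hk0 : 0 ≤ k := by omega
    -- The slack `k` is spread evenly over the six vertices, whose sum is six times the centre; the
    -- factor `6` keeps the weights integral.
    refine mem_smul_of_sum_eq (M := 6 * (ℓ : ℤ) ^ 2) ⟨a 0 + a 1, by simp⟩
      ![6 * r₂ + k, 6 * q₂ + k, 6 * p₂ + k, 6 * r₁ + k, 6 * q₁ + k, 6 * p₁ + k]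
      ![a 0 + a 1, a 0 + a 2, a 1 + a 2,
        a 0 + a 1 + 2 • a 2, a 0 + a 2 + 2 • a 1, a 1 + a 2 + 2 • a 0] ?_ ?_ (by positivity) ?_ ?_
    · intro i
      fin_cases i <;> simp
    · intro i
      fin_cases i <;> simp <;> omega
    · rw [mul_assoc, ← hm]
      simp [Fin.sum_univ_six]
      omega
    · rw [mul_smul, ← hz]
      clear hp hq hr
      obtain rfl : p = p₁ - p₂ + m := by omega
      obtain rfl : q = q₁ - q₂ + m := by omega
      obtain rfl : r = r₁ - r₂ + m := by omega
      ext i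
      simp [Fin.sum_univ_six]
      rw [hk]
      ring

theorem latticeCount_tetrahedron (hℓ : 0 < ℓ) (ha : IsCubeMatrix ℓ a) {T : Set (Fin 3 → ℝ)}
    (hT : T = tetrahedron a ∨ T = tetrahedron' a) (t : ℕ) :
    latticeCount T t = (simplexPoints (baryCoord a).range (2 * (ℓ : ℤ) ^ 2 * t)).card := by
  have h : latticeCount (tetrahedron a) t =
      (simplexPoints (baryCoord a).range (2 * (ℓ : ℤ) ^ 2 * t)).card := by
    simp only [latticeCount, mem_smul_tetrahedron hℓ ha]
    exact ncard_setOf_baryCoord_mem hℓ ha fun x hx => (mem_simplexPoints.1 hx).1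
  rcases hT with rfl | rfl
  · exact h
  · rw [tetrahedron'_eq, latticeCount_image _ _ (by norm_num)]
    exact h

theorem latticeCount_octahedron (hℓ : 0 < ℓ) (ha : IsCubeMatrix ℓ a) {O : Set (Fin 3 → ℝ)}
    (hO : O = octahedron a ∨ O = octahedron' a) (t : ℕ) :
    latticeCount O t = (octahedronPoints (baryCoord a).range (2 * (ℓ : ℤ) ^ 2 * t)).card := by
  have h : latticeCount (octahedron' a) t =
      (octahedronPoints (baryCoord a).range (2 * (ℓ : ℤ) ^ 2 * t)).card := by
    simp only [latticeCount, mem_smul_octahedron' hℓ ha]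
    exact ncard_setOf_baryCoord_mem hℓ ha fun x hx =>
      (mem_simplexPoints.1 (Finset.mem_filter.1 hx).1).1
  rcases hO with rfl | rfl
  · rw [← h, octahedron'_eq, latticeCount_image _ _ (by norm_num)]
    rfl
  · exact h

end LatticeCube

theorem theorem4p2 (ℓ : ℕ) (hℓ : 0 < ℓ) (a : Matrix (Fin 3) (Fin 3) ℤ)
    (ha : LatticeCube.IsCubeMatrix ℓ a)
    (T O : Set (Fin 3 → ℝ))
    (hT : T = LatticeCube.tetrahedron a ∨ T = LatticeCube.tetrahedron' a)
    (hO : O = LatticeCube.octahedron a ∨ O = LatticeCube.octahedron' a) :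
    ∃ μ₁ μ₂ ν₁ ν₂ : ℚ,
      (∀ t : ℕ, (LatticeCube.latticeCount T t : ℚ) =
        (ℓ : ℚ) ^ 3 / 3 * (t : ℚ) ^ 3 + μ₁ * (t : ℚ) ^ 2 + μ₂ * (t : ℚ) + 1) ∧
      (∀ t : ℕ, (LatticeCube.latticeCount O t : ℚ) =
        4 * (ℓ : ℚ) ^ 3 / 3 * (t : ℚ) ^ 3 + ν₁ * (t : ℚ) ^ 2 + ν₂ * (t : ℚ) + 1) ∧
      ν₂ + 2 * μ₂ =
        (LatticeCube.gcd3 (a 0 + a 1) : ℚ) + (LatticeCube.gcd3 (a 0 + a 2) : ℚ)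
          + (LatticeCube.gcd3 (a 1 + a 2) : ℚ)
          + (LatticeCube.gcd3 (a 0 - a 1) : ℚ) + (LatticeCube.gcd3 (a 0 - a 2) : ℚ)
          + (LatticeCube.gcd3 (a 2 - a 1) : ℚ) := by
  obtain ⟨μ₁, μ₂, ν₁, ν₂, hμ, hν, h⟩ :=
    LatticeCube.exists_card_simplexPoints_octahedronPoints
      (LatticeCube.containsMultiples_range_baryCoord hℓ ha)
  -- The cubic coefficient of the simplex becomes `2ℓ³ / 6 = ℓ³ / 3`.
  rw [LatticeCube.card_boxPoints_range_baryCoord hℓ ha] at hμ hν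
  rw [LatticeCube.edgeCount_range_baryCoord hℓ ha] at h
  refine ⟨μ₁, μ₂, ν₁, ν₂, fun t => ?_, fun t => ?_, ?_⟩
  · rw [LatticeCube.latticeCount_tetrahedron hℓ ha hT, hμ]
    push_cast
    ring
  · rw [LatticeCube.latticeCount_octahedron hℓ ha hO, hν]
    push_cast
    ring
  · exact_mod_cast h
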